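/- For $n\ge 1$, consider the partitions of $n$ whose odd parts are, for some $k\ge 1$, exactly $1,3,\dots,2k-1$ (each appearing at least once, with any multiplicity), and whose only possible even part is $2k$, one plus the largest odd part, which may appear any number of times or not at all. Let $p_1(n)$ be the weighted number of these partitions, where a partition has weight $(-1)^{a+b}$, with $a$ the number of repetitions of odd parts (an odd part appearing $c$ times contributes $c-1$ to $a$) and $b$ the number of appearances of the even part. Then both power series below converge for $0<z<1$ and, as $z\to 1^-$ through real values, $$\sum_{n\ge 1}p_1(n)z^n=O\left(\frac{1}{1-z}\right)$$ and $$\sum_{\substack{n\ge 1\\ p_1(n)>0}}z^n=O\left(\frac{1}{(1-z)\sqrt{\log\left(\frac{1}{1-z}\right)}}\right).$$ -/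

import Mathlib

open Filter Topology Asymptotics

/-- The odd parts of `μ` are exactly `1, 3, …, L` for some odd `L` (each appearing at least once),
and every even part of `μ` equals `L + 1`. -/
def IsGapFreeOdd {n : ℕ} (μ : n.Partition) : Prop :=
  ∃ L : ℕ, Odd L ∧ (∀ m : ℕ, Odd m → (m ∈ μ.parts ↔ m ≤ L)) ∧
    ∀ m ∈ μ.parts, Even m → m = L + 1

/-- The number of repetitions of odd parts: each odd part of multiplicity `c` contributes the
`c - 1` appearances after its first one. -/
def oddRepetitions {n : ℕ} (μ : n.Partition) : ℕ :=
  ∑ m ∈ μ.parts.toFinset with Odd m, (μ.parts.count m - 1)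

/-- The number of appearances of even parts, counted with multiplicity. -/
def evenAppearances {n : ℕ} (μ : n.Partition) : ℕ :=
  μ.parts.countP (fun m => Even m)

open Classical in
/-- The weighted number of partitions of `n` satisfying `IsGapFreeOdd`. -/
noncomputable def p₁ (n : ℕ) : ℤ :=
  ∑ μ : n.Partition with IsGapFreeOdd μ, (-1) ^ (oddRepetitions μ + evenAppearances μ)

/-! Removing one copy of each odd part 1, 3, …, 2r-1 (total r²) turns the weight into (-1) to the
number of remaining parts. So the generating function of `p₁` is the sum over r ≥ 1 of X^(r²) /
((1+X)(1+X³)⋯(1+X^(2r-1))(1+X^(2r))).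

The heart of the proof is that this equals the indefinite theta series ∑ (-1)^(r+j) X^(2r²-j²) over
r ≥ 1 and -r < j ≤ r (`sum_coeff_gapFreeTerm`). Put p = -X, so that 1 + X^(odd) becomes 1 - p^(odd).
A Bailey pair built on the partial theta sums ∑ p^(-j²) (`sum_invTheta_div_qFac`) expands each
summand along a kernel (`sum_invTheta_mul_baileyKernel`). After exchanging summations the kernel
sums to 1, with an error of high X-adic order (`isXPowMultiple_sum_baileyKernel_sub_one`).

Hence |p₁(n)| is at most the number of (r, j) with n = 2r² - j². Each r contributes 2r exponents,
all at least r², so ∑ |p₁(n)| z^n ≤ ∑ 2r z^(r²) ≤ 2/(1-z).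

For the second bound only p₁(n) ≠ 0 is used: then n = 2r² - j², and dividing by gcd(r, j)² gives n =
g²k, where 2 is a square modulo every odd prime factor of k, so these primes are ±1 mod 8. Such k
have density about 1/√log: the square of their Dirichlet series is controlled by ζ(s)L(s, χ₈), which
has at most a simple pole at 1 (`sq_sum_rpow_le_norm_LSeries`). This gives ∑ 1/k ≪ √log N, and a von
Mangoldt convolution with Chebyshev's bound upgrades it to a count ≪ N/√log N
(`card_twoSplit_mul_log_le`). Summing over g and then over n transfers this to the power series. -/

/-- The `q`-factorial product `(1 - q) (1 - q ^ 2) ⋯ (1 - q ^ n)`. -/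
def qFac {R : Type*} [CommRing R] (q : R) (n : ℕ) : R :=
  ∏ i ∈ Finset.range n, (1 - q ^ (i + 1))

section qFac

variable {R : Type*} [CommRing R] (q : R)

@[simp] lemma qFac_zero : qFac q 0 = 1 := by simp [qFac]

lemma qFac_succ (n : ℕ) : qFac q (n + 1) = qFac q n * (1 - q ^ (n + 1)) := by
  simp [qFac, Finset.prod_range_succ]

lemma map_qFac {S : Type*} [CommRing S] (f : R →+* S) (n : ℕ) :
    f (qFac q n) = qFac (f q) n := by
  simp [qFac, map_prod]

end qFac

/-! ### Finite q-series identities: the Bailey pair of partial theta sums -/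

section Field

variable {K : Type*} [Field K] {p : K}

lemma one_sub_pow_ne_zero (hp : ∀ n : ℕ, 0 < n → p ^ n ≠ 1) {n : ℕ} (hn : 0 < n) :
    1 - p ^ n ≠ 0 :=
  sub_ne_zero.2 (hp n hn).symm

lemma pow_sq_ne_one (hp : ∀ n : ℕ, 0 < n → p ^ n ≠ 1) (n : ℕ) (hn : 0 < n) :
    (p ^ 2) ^ n ≠ 1 := by
  rw [← pow_mul]; exact hp _ (by positivity)

lemma one_add_pow_ne_zero (hp : ∀ n : ℕ, 0 < n → p ^ n ≠ 1) {n : ℕ} (hn : 0 < n) :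
    1 + p ^ n ≠ 0 := by
  intro h
  apply hp (n * 2) (by positivity)
  rw [pow_mul]
  linear_combination (p ^ n - 1) * h

lemma qFac_ne_zero (hp : ∀ n : ℕ, 0 < n → p ^ n ≠ 1) (n : ℕ) : qFac p n ≠ 0 :=
  Finset.prod_ne_zero_iff.2 fun _ _ => one_sub_pow_ne_zero hp (Nat.succ_pos _)

/-- Special value of the Rogers–Szegő polynomials. -/
lemma sum_pow_div_qFac_sq (hp : ∀ n : ℕ, 0 < n → p ^ n ≠ 1) (n : ℕ) :
    ∑ m ∈ Finset.range (n + 1), p ^ m / (qFac (p ^ 2) m * qFac (p ^ 2) (n - m)) =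
      1 / qFac p n := by
  have hF := qFac_ne_zero (pow_sq_ne_one hp)
  induction n with
  | zero => simp
  | succ n ih =>
    set f : ℕ → K := fun m => p ^ m / (qFac (p ^ 2) m * qFac (p ^ 2) (n - m)) with hf
    -- With q = p², split 1 - q^(n+1) = (1 - q^(n+1-m)) + q^(n+1-m)(1 - q^m). Each piece cancels the
    -- last factor of one of the two q-factorials, so both reduce to the sum for n; the second does
    -- so after the reflection m ↦ n - m. The outcome `h3` is a first-order recurrence.
    have h1 : ∑ m ∈ Finset.range (n + 2), (1 - (p ^ 2) ^ (n + 1 - m)) *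
        (p ^ m / (qFac (p ^ 2) m * qFac (p ^ 2) (n + 1 - m))) =
        ∑ m ∈ Finset.range (n + 1), f m := by
      rw [Finset.sum_range_succ]
      simp only [Nat.sub_self, pow_zero, sub_self, zero_mul, add_zero]
      refine Finset.sum_congr rfl fun m hm => ?_
      have hm' : n + 1 - m = (n - m) + 1 := by
        have := Finset.mem_range.1 hm; omega
      have h0 := one_sub_pow_ne_zero (pow_sq_ne_one hp) (Nat.succ_pos (n - m))
      simp only [hf]
      rw [hm', qFac_succ]
      have := hF m
      have := hF (n - m)
      field_simp
    have h2 : ∑ m ∈ Finset.range (n + 2), (p ^ 2) ^ (n + 1 - m) * (1 - (p ^ 2) ^ m) *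
        (p ^ m / (qFac (p ^ 2) m * qFac (p ^ 2) (n + 1 - m))) =
        p ^ (n + 1) * ∑ m ∈ Finset.range (n + 1), f m := by
      rw [Finset.sum_range_succ', ← Finset.sum_range_reflect, Finset.mul_sum]
      simp only [pow_zero, sub_self, mul_zero, zero_mul, add_zero]
      refine Finset.sum_congr rfl fun m hm => ?_
      obtain ⟨d, rfl⟩ := Nat.exists_eq_add_of_le (Nat.lt_succ_iff.1 (Finset.mem_range.1 hm))
      have e1 : m + d + 1 - 1 - m = d := by omega
      have e2 : m + d + 1 - (d + 1) = m := by omega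
      have e3 : m + d - m = d := by omega
      have h0 := one_sub_pow_ne_zero (pow_sq_ne_one hp) (Nat.succ_pos d)
      simp only [hf, e1, e2, e3]
      rw [qFac_succ]
      have := hF m
      have := hF d
      field_simp
      ring
    have h3 : (1 - (p ^ 2) ^ (n + 1)) * ∑ m ∈ Finset.range (n + 2),
        p ^ m / (qFac (p ^ 2) m * qFac (p ^ 2) (n + 1 - m)) =
        (1 + p ^ (n + 1)) * ∑ m ∈ Finset.range (n + 1), f m := by
      rw [add_mul, one_mul, ← h2, ← h1, ← Finset.sum_add_distrib, Finset.mul_sum]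
      refine Finset.sum_congr rfl fun m hm => ?_
      have hm' : m + (n + 1 - m) = n + 1 := by
        have := Finset.mem_range.1 hm; omega
      have : (p ^ 2) ^ (n + 1) = (p ^ 2) ^ m * (p ^ 2) ^ (n + 1 - m) := by
        rw [← pow_add, hm']
      rw [this]
      ring
    rw [ih] at h3
    have h4 := one_add_pow_ne_zero hp (Nat.succ_pos n)
    have h5 := one_sub_pow_ne_zero hp (Nat.succ_pos n)
    have h6 := qFac_ne_zero hp n
    have h7 := one_sub_pow_ne_zero (pow_sq_ne_one hp) (Nat.succ_pos n)
    simp only [Nat.succ_eq_add_one] at h4 h5 h7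
    apply mul_left_cancel₀ h7
    rw [h3, qFac_succ]
    field_simp
    ring

/-- The sum of `p ^ (-j ^ 2)` over `-r < j ≤ r`. -/
def invTheta (p : K) (r : ℕ) : K :=
  ∑ i ∈ Finset.range r, ((p ^ (i + 1) ^ 2)⁻¹ + (p ^ i ^ 2)⁻¹)

lemma invTheta_succ (p : K) (r : ℕ) :
    invTheta p (r + 1) = invTheta p r + ((p ^ (r + 1) ^ 2)⁻¹ + (p ^ r ^ 2)⁻¹) := by
  simp [invTheta, Finset.sum_range_succ]

/-- Summation by parts. Passing from `invTheta p m` to `invTheta p (m + 1)` adds p^(-(m+1)²) +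
p^(-m²), which the weight p^(m(m+1)) turns into p^(-(m+1)) + p^m. The boundary term carries the
factor 1 - (p²)^(k+1-m) so that it vanishes at m = k + 1. -/
lemma sum_invTheta_partial (h0 : p ≠ 0) (hp : ∀ n : ℕ, 0 < n → p ^ n ≠ 1) (k m : ℕ)
    (hm : m ≤ k + 1) :
    (1 + (p ^ 2) ^ (k + 1)) * ∑ i ∈ Finset.range m,
      p ^ (i * (i + 1)) * (1 - (p ^ 2) ^ (i + 1)) * invTheta p (i + 1) /
        (qFac (p ^ 2) (k - i) * qFac (p ^ 2) (k + i + 2)) =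
    (∑ i ∈ Finset.range m, ((p ^ (i + 1))⁻¹ + p ^ i) /
        (qFac (p ^ 2) (k - i) * qFac (p ^ 2) (k + i + 1))) -
      invTheta p m * p ^ (m * (m + 1)) * (1 - (p ^ 2) ^ (k + 1 - m)) /
        (qFac (p ^ 2) (k + 1 - m) * qFac (p ^ 2) (k + m + 1)) := by
  have hF := qFac_ne_zero (pow_sq_ne_one hp)
  induction m with
  | zero => simp [invTheta]
  | succ m ih =>
    obtain ⟨d, rfl⟩ := Nat.exists_eq_add_of_le (Nat.le_of_succ_le_succ hm)
    have e1 : m + d + 1 - m = d + 1 := by omega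
    have e2 : m + d - m = d := by omega
    have e3 : m + d + 1 - (m + 1) = d := by omega
    rw [Finset.sum_range_succ, mul_add, ih (by omega), Finset.sum_range_succ, e1, e2, e3,
      invTheta_succ]
    rw [show m + d + m + 2 = (m + d + m + 1) + 1 by ring,
      show m + d + (m + 1) + 1 = (m + d + m + 1) + 1 by ring, qFac_succ _ d,
      qFac_succ _ (m + d + m + 1)]
    have a1 := hF d
    have a2 := hF (m + d + m + 1)
    have a3 := one_sub_pow_ne_zero (pow_sq_ne_one hp) (Nat.succ_pos d)
    have a4 := one_sub_pow_ne_zero (pow_sq_ne_one hp) (Nat.succ_pos (m + d + m + 1))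
    simp only [Nat.succ_eq_add_one] at a3 a4
    set S := ∑ i ∈ Finset.range m, ((p ^ (i + 1))⁻¹ + p ^ i) /
        (qFac (p ^ 2) (m + d - i) * qFac (p ^ 2) (m + d + i + 1))
    generalize invTheta p m = T
    have c1 : (p ^ (m + 1) ^ 2)⁻¹ = (p ^ (m * (m + 1)))⁻¹ * (p ^ (m + 1))⁻¹ := by
      rw [← mul_inv, ← pow_add]; congr 2; ring
    have c2 : (p ^ m ^ 2)⁻¹ = (p ^ (m * (m + 1)))⁻¹ * p ^ m := by
      rw [eq_comm, inv_mul_eq_iff_eq_mul₀ (pow_ne_zero _ h0), eq_comm,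
        mul_inv_eq_iff_eq_mul₀ (pow_ne_zero _ h0), ← pow_add]
      congr 1; ring
    have c3 : p ^ ((m + 1) * (m + 1 + 1)) = p ^ (m * (m + 1)) * (p ^ 2) ^ (m + 1) := by
      rw [← pow_mul, ← pow_add]; congr 1; ring
    have c4 : (p ^ 2) ^ (m + d + m + 1 + 1) = (p ^ 2) ^ (m + 1) * ((p ^ 2) ^ (m + 1) *
        (p ^ 2) ^ d) := by
      rw [← pow_add, ← pow_add]; congr 1; ring
    have c5 : (p ^ 2) ^ (m + d + 1) = (p ^ 2) ^ (m + 1) * (p ^ 2) ^ d := by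
      rw [← pow_add]; congr 1; ring
    have a5 : p ^ (m * (m + 1)) ≠ 0 := pow_ne_zero _ h0
    have a6 : p ^ (m + 1) ≠ 0 := pow_ne_zero _ h0
    rw [c1, c2, c3]
    rw [c4] at a4 ⊢
    rw [c5]
    generalize p ^ (m * (m + 1)) = A at *
    generalize p ^ (m + 1) = B at *
    generalize (p ^ 2) ^ (m + 1) = D at *
    generalize p ^ m = E at *
    generalize qFac (p ^ 2) d = F at *
    generalize qFac (p ^ 2) (m + d + m + 1) = G at *
    generalize hu : 1 - (p ^ 2) ^ (d + 1) = u at *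
    generalize (p ^ 2) ^ d = H at *
    generalize hw : 1 - D * (D * H) = v at *
    -- This splitting drives the telescoping: the `v` part removes the old boundary term and
    -- produces the new summand, while the other part is the new boundary term.
    have hv' : (1 + D * H) * (1 - D) = v - D * (1 - H) := by rw [← hw]; ring
    rw [show (1 + D * H) * (A * (1 - D) * (T + (A⁻¹ * B⁻¹ + A⁻¹ * E)) / (F * (G * v))) =
      ((1 + D * H) * (1 - D)) * (A * (T + (A⁻¹ * B⁻¹ + A⁻¹ * E)) / (F * (G * v))) by ring, hv']
    field_simp
    ring

lemma sum_invTheta_div_qFac (h0 : p ≠ 0) (hp : ∀ n : ℕ, 0 < n → p ^ n ≠ 1) (k : ℕ) :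
    (1 + (p ^ 2) ^ (k + 1)) * ∑ i ∈ Finset.range (k + 1),
      p ^ (i * (i + 1)) * (1 - (p ^ 2) ^ (i + 1)) * invTheta p (i + 1) /
        (qFac (p ^ 2) (k - i) * qFac (p ^ 2) (k + i + 2)) =
      (p ^ (k + 1))⁻¹ / qFac p (2 * k + 1) := by
  rw [sum_invTheta_partial h0 hp k (k + 1) le_rfl]
  simp only [Nat.sub_self, pow_zero, sub_self, mul_zero, zero_div, sub_zero]
  have key := sum_pow_div_qFac_sq hp (2 * k + 1)
  -- The indices 0, …, 2k+1 are folded about the middle, pairing k - i with k + 1 + i; both members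
  -- of a pair have the same denominator.
  rw [show 2 * k + 1 + 1 = (k + 1) + (k + 1) by ring, Finset.sum_range_add,
    ← Finset.sum_range_reflect, ← Finset.sum_add_distrib] at key
  rw [div_eq_mul_one_div, ← key, Finset.mul_sum]
  refine Finset.sum_congr rfl fun i hi => ?_
  obtain ⟨d, rfl⟩ := Nat.exists_eq_add_of_le (Nat.lt_succ_iff.1 (Finset.mem_range.1 hi))
  have e1 : i + d + 1 - 1 - i = d := by omega
  have e2 : 2 * (i + d) + 1 - d = i + d + i + 1 := by omega
  have e3 : 2 * (i + d) + 1 - (i + d + 1 + i) = d := by omega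
  have e4 : i + d - i = d := by omega
  have e5 : i + d + 1 + i = i + d + i + 1 := by omega
  rw [e1, e2, e3, e4, e5]
  have a1 := qFac_ne_zero (pow_sq_ne_one hp) d
  have a2 := qFac_ne_zero (pow_sq_ne_one hp) (i + d + i + 1)
  rw [show i + d + 1 = (i + 1) + d by ring, show i + d + i + 1 = (i + 1) + d + i by ring,
    pow_add p (i + 1 + d), pow_add p (i + 1)]
  have a3 : p ^ (i + 1) ≠ 0 := pow_ne_zero _ h0
  have a4 : p ^ d ≠ 0 := pow_ne_zero _ h0
  field_simp

end Field

/-! ### The conjugate Bailey kernel and the exchange of summations -/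

section Field

variable {K : Type*} [Field K] {p : K}

/-- The kernel of the conjugate Bailey pair obtained by pairing the indices `i + 1` and
`i + m + 1`. -/
def baileyKernel (p : K) (i m : ℕ) : K :=
  (-1) ^ m * p ^ (m * (m + 2 * i + 3)) * qFac (p ^ 2) (i + m) * (1 - (p ^ 2) ^ (i + 1)) /
    (qFac (p ^ 2) m * qFac (p ^ 2) (2 * i + 2 + m))

/-- A contiguous relation: raising i by one and shortening the sum by one costs only a boundary
term, whose power of p is quadratic in L. It shows that the full kernel sum does not depend on i. -/
lemma sum_baileyKernel_sub (hp : ∀ n : ℕ, 0 < n → p ^ n ≠ 1) (i L : ℕ) :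
    ∑ m ∈ Finset.range (L + 1), baileyKernel p i m =
      ∑ m ∈ Finset.range L, baileyKernel p (i + 1) m +
      (-1) ^ L * p ^ (L * (L + 2 * i + 5)) * qFac (p ^ 2) (i + 1 + L) *
        (1 - (p ^ 2) ^ (2 * i + 3)) / (qFac (p ^ 2) L * qFac (p ^ 2) (2 * i + L + 3)) := by
  have hF := qFac_ne_zero (pow_sq_ne_one hp)
  induction L with
  | zero =>
    simp only [baileyKernel, Finset.sum_range_one, Finset.sum_range_zero, add_zero, zero_mul,
      pow_zero, zero_add, one_mul, qFac_zero]
    rw [qFac_succ _ (2 * i + 2), qFac_succ _ i]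
    have := hF (2 * i + 2)
    have := one_sub_pow_ne_zero (pow_sq_ne_one hp) (Nat.succ_pos (2 * i + 2))
    simp only [Nat.succ_eq_add_one] at this
    field_simp
  | succ L ih =>
    rw [Finset.sum_range_succ _ (L + 1), ih, Finset.sum_range_succ _ L]
    refine (add_assoc _ _ _).trans (Eq.trans ?_ (add_assoc _ _ _).symm)
    congr 1
    simp only [baileyKernel]
    rw [show i + (L + 1) = i + L + 1 by ring, show i + 1 + L = i + L + 1 by ring,
      show i + 1 + (L + 1) = i + L + 1 + 1 by ring,
      show 2 * i + L + 3 = 2 * i + L + 2 + 1 by ring,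
      show 2 * i + 2 + (L + 1) = 2 * i + L + 2 + 1 by ring,
      show 2 * (i + 1) + 2 + L = 2 * i + L + 2 + 1 + 1 by ring,
      show 2 * i + (L + 1) + 3 = 2 * i + L + 2 + 1 + 1 by ring,
      qFac_succ _ (i + L + 1), qFac_succ _ (2 * i + L + 2 + 1), qFac_succ _ L]
    have a1 := hF L
    have a2 := hF (2 * i + L + 2 + 1)
    have a3 : 1 - (p ^ 2) ^ (L + 1) ≠ 0 :=
      one_sub_pow_ne_zero (pow_sq_ne_one hp) (by omega)
    have a4 : 1 - (p ^ 2) ^ (2 * i + L + 2 + 1 + 1) ≠ 0 :=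
      one_sub_pow_ne_zero (pow_sq_ne_one hp) (by omega)
    have c1 : p ^ ((L + 1) * (L + 1 + 2 * i + 3)) =
        p ^ (L * (L + 2 * i + 5)) * (p ^ 2) ^ (i + 1) * p ^ 2 := by
      rw [← pow_mul, ← pow_add, ← pow_add]; congr 1; ring
    have c2 : p ^ (L * (L + 2 * (i + 1) + 3)) = p ^ (L * (L + 2 * i + 5)) := by
      congr 1
    have c3 : p ^ ((L + 1) * (L + 1 + 2 * i + 5)) =
        p ^ (L * (L + 2 * i + 5)) * ((p ^ 2) ^ L * (p ^ 2) ^ (i + 1) * (p ^ 2) ^ 2) := by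
      rw [← pow_mul, ← pow_mul, ← pow_mul, ← pow_add, ← pow_add, ← pow_add]; congr 1; ring
    rw [c1, c2, c3]
    have c4 : (p ^ 2) ^ (2 * i + L + 2 + 1 + 1) =
        (p ^ 2) ^ L * (p ^ 2) ^ (i + 1) * (p ^ 2) ^ (i + 1) * (p ^ 2) ^ 2 := by
      rw [← pow_add, ← pow_add, ← pow_add]; congr 1; ring
    have c5 : (p ^ 2) ^ (2 * i + 3) = (p ^ 2) ^ (i + 1) * (p ^ 2) ^ (i + 1) * p ^ 2 := by
      rw [← pow_add, ← pow_succ]; congr 1; ring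
    have c6 : (p ^ 2) ^ (i + L + 1 + 1) = (p ^ 2) ^ L * (p ^ 2) ^ (i + 1) * p ^ 2 := by
      rw [← pow_add, ← pow_succ]; congr 1; ring
    have c7 : (p ^ 2) ^ (i + 1 + 1) = (p ^ 2) ^ (i + 1) * p ^ 2 := pow_succ _ _
    have c8 : (p ^ 2) ^ (L + 1) = (p ^ 2) ^ L * p ^ 2 := pow_succ _ _
    rw [c8] at a3
    rw [c4] at a4
    rw [c4, c5, c6, c7, c8]
    clear c1 c2 c3 c4 c5 c6 c7 c8 ih hF
    generalize p ^ (L * (L + 2 * i + 5)) = A at *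
    generalize (p ^ 2) ^ (i + 1) = B at *
    generalize (p ^ 2) ^ L = D at *
    generalize qFac (p ^ 2) (i + L + 1) = E at *
    generalize qFac (p ^ 2) L = F at *
    generalize qFac (p ^ 2) (2 * i + L + 2 + 1) = G at *
    generalize p ^ 2 = Q at *
    rw [pow_succ]
    generalize ((-1) ^ L : K) = s at *
    generalize hu : 1 - D * Q = u at *
    generalize hv : 1 - D * B * B * Q ^ 2 = v at *
    field_simp
    rw [← hu, ← hv]
    ring

lemma qFac_two_mul_add_one (p : K) (k : ℕ) :
    qFac p (2 * k + 1) = qFac (p ^ 2) k * ∏ i ∈ Finset.range (k + 1), (1 - p ^ (2 * i + 1)) := by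
  induction k with
  | zero => simp [qFac]
  | succ k ih =>
    rw [show 2 * (k + 1) + 1 = 2 * k + 1 + 1 + 1 by ring, qFac_succ, qFac_succ, ih,
      qFac_succ, Finset.prod_range_succ _ (k + 1), ← pow_mul]
    ring_nf

/-- Up to a factor depending only on k, the left side is the sum in `sum_invTheta_div_qFac`. The
factor `qFac (p ^ 2) k` cancels the even-exponent factors of `qFac p (2 * k + 1)` and leaves the
product over odd exponents. -/
lemma sum_invTheta_mul_baileyKernel (h0 : p ≠ 0) (hp : ∀ n : ℕ, 0 < n → p ^ n ≠ 1) (k : ℕ) :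
    ∑ i ∈ Finset.range (k + 1), (-1) ^ (i + 1) * p ^ (2 * (i + 1) ^ 2) * invTheta p (i + 1) *
      baileyKernel p i (k - i) =
    (-1) ^ (k + 1) * p ^ (k + 1) ^ 2 /
      ((∏ i ∈ Finset.range (k + 1), (1 - p ^ (2 * i + 1))) * (1 + p ^ (2 * (k + 1)))) := by
  have hF := qFac_ne_zero (pow_sq_ne_one hp)
  have a1 := one_add_pow_ne_zero (pow_sq_ne_one hp) (Nat.succ_pos k)
  simp only [Nat.succ_eq_add_one] at a1
  have key := eq_div_of_mul_eq a1 ((mul_comm _ _).trans (sum_invTheta_div_qFac h0 hp k))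
  have : ∀ i ∈ Finset.range (k + 1),
      (-1) ^ (i + 1) * p ^ (2 * (i + 1) ^ 2) * invTheta p (i + 1) * baileyKernel p i (k - i) =
      (-1) ^ (k + 1) * p ^ ((k + 1) * (k + 2)) * qFac (p ^ 2) k *
      (p ^ (i * (i + 1)) * (1 - (p ^ 2) ^ (i + 1)) * invTheta p (i + 1) /
        (qFac (p ^ 2) (k - i) * qFac (p ^ 2) (k + i + 2))) := by
    intro i hi
    obtain ⟨d, rfl⟩ := Nat.exists_eq_add_of_le (Nat.lt_succ_iff.1 (Finset.mem_range.1 hi))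
    have e1 : i + d - i = d := by omega
    rw [e1, baileyKernel, show 2 * i + 2 + d = i + d + i + 2 by ring]
    have c1 : p ^ ((i + d + 1) * (i + d + 2)) * p ^ (i * (i + 1)) =
        p ^ (2 * (i + 1) ^ 2) * p ^ (d * (d + 2 * i + 3)) := by
      rw [← pow_add, ← pow_add]; congr 1; ring
    have c2 : (-1 : K) ^ (i + d + 1) = (-1) ^ (i + 1) * (-1) ^ d := by
      rw [← pow_add]; congr 1; ring
    rw [c2, mul_div_assoc, mul_div_assoc]
    linear_combination (-1) * (-1) ^ (i + 1) * (-1) ^ d * qFac (p ^ 2) (i + d) *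
      ((1 - (p ^ 2) ^ (i + 1)) * invTheta p (i + 1) /
      (qFac (p ^ 2) d * qFac (p ^ 2) (i + d + i + 2))) * c1
  rw [Finset.sum_congr rfl this, ← Finset.mul_sum, key, qFac_two_mul_add_one]
  have a2 := hF k
  have a3 : ∏ i ∈ Finset.range (k + 1), (1 - p ^ (2 * i + 1)) ≠ 0 :=
    Finset.prod_ne_zero_iff.2 fun i _ => one_sub_pow_ne_zero hp (by omega)
  have a4 : p ^ (k + 1) ≠ 0 := pow_ne_zero _ h0
  rw [show (k + 1) * (k + 2) = (k + 1) ^ 2 + (k + 1) by ring, pow_add, pow_mul p 2 (k + 1)]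
  field_simp
  ring

lemma sum_product_eq_sum_invTheta (h0 : p ≠ 0) (hp : ∀ n : ℕ, 0 < n → p ^ n ≠ 1) (M : ℕ) :
    ∑ k ∈ Finset.range M, (-1) ^ (k + 1) * p ^ (k + 1) ^ 2 /
      ((∏ i ∈ Finset.range (k + 1), (1 - p ^ (2 * i + 1))) * (1 + p ^ (2 * (k + 1)))) =
    ∑ i ∈ Finset.range M, (-1) ^ (i + 1) * p ^ (2 * (i + 1) ^ 2) * invTheta p (i + 1) *
      ∑ m ∈ Finset.range (M - i), baileyKernel p i m := by
  simp_rw [← sum_invTheta_mul_baileyKernel h0 hp]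
  rw [Finset.sum_comm' (t' := Finset.range M) (s' := fun i => Finset.Ico i M)]
  · refine Finset.sum_congr rfl fun i _ => ?_
    rw [Finset.sum_Ico_eq_sum_range, Finset.mul_sum]
    simp
  · intro x y
    simp only [Finset.mem_range, Finset.mem_Ico]
    omega

end Field

/-! ### Passing to formal power series at p = -X, X-adically; the fraction field accommodates
negative powers of p -/

section PowerSeries

open PowerSeries

/-- `x` is the image of a power series divisible by `X ^ N`. -/
def IsXPowMultiple (N : ℕ) (x : FractionRing ℚ⟦X⟧) : Prop :=
  ∃ f : ℚ⟦X⟧, x = algebraMap ℚ⟦X⟧ (FractionRing ℚ⟦X⟧) (X ^ N * f)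

namespace IsXPowMultiple

variable {M N : ℕ} {x y : FractionRing ℚ⟦X⟧}

lemma add (hx : IsXPowMultiple N x) (hy : IsXPowMultiple N y) : IsXPowMultiple N (x + y) := by
  obtain ⟨f, rfl⟩ := hx
  obtain ⟨g, rfl⟩ := hy
  exact ⟨f + g, by rw [← map_add, mul_add]⟩

lemma mul (hx : IsXPowMultiple M x) (hy : IsXPowMultiple N y) :
    IsXPowMultiple (M + N) (x * y) := by
  obtain ⟨f, rfl⟩ := hx
  obtain ⟨g, rfl⟩ := hy
  exact ⟨f * g, by rw [← map_mul, pow_add]; congr 1; ring⟩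

lemma mono (h : M ≤ N) (hx : IsXPowMultiple N x) : IsXPowMultiple M x := by
  obtain ⟨f, rfl⟩ := hx
  obtain ⟨d, rfl⟩ := Nat.exists_eq_add_of_le h
  exact ⟨X ^ d * f, by rw [pow_add, mul_assoc]⟩

lemma zero : IsXPowMultiple N 0 := ⟨0, by simp⟩

lemma sum {ι : Type*} (s : Finset ι) (f : ι → FractionRing ℚ⟦X⟧)
    (h : ∀ i ∈ s, IsXPowMultiple N (f i)) : IsXPowMultiple N (∑ i ∈ s, f i) :=
  Finset.sum_induction _ _ (fun _ _ => add) zero h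

lemma of_algebraMap (f : ℚ⟦X⟧) : IsXPowMultiple 0 (algebraMap ℚ⟦X⟧ (FractionRing ℚ⟦X⟧) f) :=
  ⟨f, by simp⟩

lemma inv (f : ℚ⟦X⟧) (hf : constantCoeff f ≠ 0) :
    IsXPowMultiple 0 (algebraMap ℚ⟦X⟧ (FractionRing ℚ⟦X⟧) f)⁻¹ := by
  refine ⟨f⁻¹, ?_⟩
  rw [pow_zero, one_mul]
  refine inv_eq_of_mul_eq_one_right ?_
  rw [← map_mul, PowerSeries.mul_inv_cancel f hf, map_one]

end IsXPowMultiple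

/-- The image of `-X` in the fraction field. -/
noncomputable def negX : FractionRing ℚ⟦X⟧ := algebraMap ℚ⟦X⟧ (FractionRing ℚ⟦X⟧) (-X)

lemma negX_ne_zero : negX ≠ 0 := by
  simp [negX]

lemma negX_pow_ne_one (n : ℕ) (hn : 0 < n) : negX ^ n ≠ 1 := by
  rw [negX, ← map_pow]
  intro h
  have h2 := IsFractionRing.injective ℚ⟦X⟧ (FractionRing ℚ⟦X⟧) (h.trans (map_one _).symm)
  have := congrArg (constantCoeff (R := ℚ)) h2
  simp [hn.ne'] at this

lemma isXPowMultiple_negX_pow (n : ℕ) : IsXPowMultiple n (negX ^ n) :=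
  ⟨(-1) ^ n, by rw [negX, ← map_pow, neg_pow]; ring_nf⟩

lemma constantCoeff_qFac (n : ℕ) : constantCoeff (qFac ((-X : ℚ⟦X⟧) ^ 2) n) = 1 := by
  rw [map_qFac]
  simp [qFac]

lemma negX_sq_qFac (n : ℕ) : qFac (negX ^ 2) n = algebraMap _ _ (qFac ((-X : ℚ⟦X⟧) ^ 2) n) := by
  rw [map_qFac, map_pow, negX]

lemma isXPowMultiple_qFac (n : ℕ) : IsXPowMultiple 0 (qFac (negX ^ 2) n) := by
  rw [negX_sq_qFac]; exact .of_algebraMap _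

lemma isXPowMultiple_inv_qFac (n : ℕ) : IsXPowMultiple 0 (qFac (negX ^ 2) n)⁻¹ := by
  rw [negX_sq_qFac]; exact .inv _ (by rw [constantCoeff_qFac]; exact one_ne_zero)

lemma isXPowMultiple_one_sub (n : ℕ) : IsXPowMultiple 0 (1 - (negX ^ 2) ^ n) := by
  rw [negX, ← map_pow, ← map_pow, ← map_one (algebraMap ℚ⟦X⟧ (FractionRing ℚ⟦X⟧)), ← map_sub]
  exact .of_algebraMap _

lemma isXPowMultiple_neg_one_pow (n : ℕ) : IsXPowMultiple 0 ((-1) ^ n) := by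
  rw [show (-1 : FractionRing ℚ⟦X⟧) ^ n = algebraMap ℚ⟦X⟧ (FractionRing ℚ⟦X⟧) ((-1) ^ n) by simp]
  exact .of_algebraMap _

lemma isXPowMultiple_qFac_sub (r j : ℕ) :
    IsXPowMultiple (r + 1) (qFac (negX ^ 2) r - qFac (negX ^ 2) (r + j)) := by
  induction j with
  | zero => simpa using IsXPowMultiple.zero
  | succ j ih =>
    rw [show qFac (negX ^ 2) r - qFac (negX ^ 2) (r + (j + 1)) =
      (qFac (negX ^ 2) r - qFac (negX ^ 2) (r + j)) +
        negX ^ (2 * (r + j + 1)) * qFac (negX ^ 2) (r + j) by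
        rw [← add_assoc, qFac_succ, ← pow_mul]; ring]
    exact ih.add (((isXPowMultiple_negX_pow _).mul (isXPowMultiple_qFac _)).mono (by omega))

/-- The full kernel sum is 1; this is its truncated form. Each use of `sum_baileyKernel_sub` trades
(i, L + 1) for (i + 1, L), preserving i + L, and its boundary term has high enough order. At L = 0
the sum is the quotient of the q-factorials of indices i + 1 and 2i + 2, which agree to the required
order. -/
lemma isXPowMultiple_sum_baileyKernel_sub_one (i L : ℕ) :
    IsXPowMultiple (i + L + 1) (∑ m ∈ Finset.range (L + 1), baileyKernel negX i m - 1) := by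
  have hF := qFac_ne_zero (pow_sq_ne_one negX_pow_ne_one)
  induction L generalizing i with
  | zero =>
    have : ∑ m ∈ Finset.range (0 + 1), baileyKernel negX i m - 1 =
        (qFac (negX ^ 2) (i + 1) - qFac (negX ^ 2) (i + 1 + (i + 1))) *
          (qFac (negX ^ 2) (2 * i + 2))⁻¹ := by
      rw [show i + 1 + (i + 1) = 2 * i + 2 by ring, qFac_succ _ i]
      have := hF (2 * i + 2)
      simp only [zero_add, Finset.sum_range_one, baileyKernel, pow_zero, zero_mul, one_mul,
        add_zero, qFac_zero]
      field_simp
    rw [this]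
    exact ((isXPowMultiple_qFac_sub _ _).mul (isXPowMultiple_inv_qFac _)).mono (by omega)
  | succ L ih =>
    rw [sum_baileyKernel_sub negX_pow_ne_one, add_sub_right_comm, div_eq_mul_inv, mul_inv]
    refine ((ih (i + 1)).mono (by omega)).add ?_
    refine ((((((isXPowMultiple_neg_one_pow _).mul (isXPowMultiple_negX_pow _)).mul
      (isXPowMultiple_qFac _)).mul (isXPowMultiple_one_sub _)).mul
      ((isXPowMultiple_inv_qFac _).mul (isXPowMultiple_inv_qFac _)))).mono ?_
    nlinarith

/-- The indefinite theta summand `∑ (-1) ^ (r + j) X ^ (2 r ^ 2 - j ^ 2)` over `-r < j ≤ r`, for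
`r = i + 1`. -/
noncomputable def heckeTerm (i : ℕ) : ℚ⟦X⟧ :=
  (-1) ^ (i + 1) * ∑ l ∈ Finset.range (i + 1),
    ((-X) ^ (2 * (i + 1) ^ 2 - (l + 1) ^ 2) + (-X) ^ (2 * (i + 1) ^ 2 - l ^ 2))

lemma algebraMap_heckeTerm (i : ℕ) : algebraMap ℚ⟦X⟧ (FractionRing ℚ⟦X⟧) (heckeTerm i) =
    (-1) ^ (i + 1) * negX ^ (2 * (i + 1) ^ 2) * invTheta negX (i + 1) := by
  rw [heckeTerm, invTheta, mul_assoc, map_mul, map_sum]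
  congr 1
  · simp
  rw [Finset.mul_sum]
  refine Finset.sum_congr rfl fun l hl => ?_
  have hl' := Finset.mem_range.1 hl
  have e1 : (l + 1) ^ 2 ≤ 2 * (i + 1) ^ 2 := by nlinarith
  have e2 : l ^ 2 ≤ 2 * (i + 1) ^ 2 := by nlinarith
  rw [map_add, map_pow, map_pow, mul_add, ← negX, pow_sub₀ _ negX_ne_zero e1,
    pow_sub₀ _ negX_ne_zero e2]

lemma isXPowMultiple_heckeTerm (i : ℕ) :
    IsXPowMultiple 1 (algebraMap ℚ⟦X⟧ (FractionRing ℚ⟦X⟧) (heckeTerm i)) := by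
  rw [heckeTerm, map_mul, map_sum]
  refine (IsXPowMultiple.mul (IsXPowMultiple.of_algebraMap _) (IsXPowMultiple.sum (N := 1) _ _
    fun l hl => ?_)).mono le_rfl
  have hl' := Finset.mem_range.1 hl
  have e1 : 1 ≤ 2 * (i + 1) ^ 2 - (l + 1) ^ 2 := by
    have : (l + 1) ^ 2 ≤ (i + 1) ^ 2 := Nat.pow_le_pow_left (by omega) 2
    have : 1 ≤ (i + 1) ^ 2 := Nat.one_le_pow _ _ (by omega)
    omega
  have e2 : 1 ≤ 2 * (i + 1) ^ 2 - l ^ 2 := by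
    have : l ^ 2 ≤ (i + 1) ^ 2 := Nat.pow_le_pow_left (by omega) 2
    have : 1 ≤ (i + 1) ^ 2 := Nat.one_le_pow _ _ (by omega)
    omega
  rw [map_add, map_pow, map_pow, ← negX]
  exact ((isXPowMultiple_negX_pow _).mono e1).add ((isXPowMultiple_negX_pow _).mono e2)

/-- The generating function of the gap-free partitions with largest odd part `2 k + 1`. -/
noncomputable def gapFreeTerm (k : ℕ) : ℚ⟦X⟧ :=
  X ^ (k + 1) ^ 2 *
    ((∏ i ∈ Finset.range (k + 1), (1 + X ^ (2 * i + 1))) * (1 + X ^ (2 * (k + 1))))⁻¹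

/-- Under p = -X odd powers change sign and even powers do not; the signs in the numerator cancel
because (k + 1) + (k + 1)² is even. -/
lemma algebraMap_gapFreeTerm (k : ℕ) : algebraMap ℚ⟦X⟧ (FractionRing ℚ⟦X⟧) (gapFreeTerm k) =
    (-1) ^ (k + 1) * negX ^ (k + 1) ^ 2 /
      ((∏ i ∈ Finset.range (k + 1), (1 - negX ^ (2 * i + 1))) * (1 + negX ^ (2 * (k + 1)))) := by
  have e1 : (∏ i ∈ Finset.range (k + 1), (1 - negX ^ (2 * i + 1))) *
      (1 + negX ^ (2 * (k + 1))) = algebraMap ℚ⟦X⟧ (FractionRing ℚ⟦X⟧)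
      ((∏ i ∈ Finset.range (k + 1), (1 + X ^ (2 * i + 1))) * (1 + X ^ (2 * (k + 1)))) := by
    rw [map_mul, map_prod, negX]
    congr 1
    · refine Finset.prod_congr rfl fun i _ => ?_
      rw [← map_pow, Odd.neg_pow ⟨i, rfl⟩]
      simp
    · rw [← map_pow, Even.neg_pow ⟨k + 1, by ring⟩]
      simp
  have e2 : (-1) ^ (k + 1) * negX ^ (k + 1) ^ 2 =
      algebraMap ℚ⟦X⟧ (FractionRing ℚ⟦X⟧) (X ^ (k + 1) ^ 2) := by
    rw [negX, map_neg, neg_pow (algebraMap ℚ⟦X⟧ (FractionRing ℚ⟦X⟧) X), ← mul_assoc, ← pow_add,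
      Even.neg_one_pow, one_mul, map_pow]
    rw [show k + 1 + (k + 1) ^ 2 = (k + 1) * (k + 1 + 1) by ring]
    exact Nat.even_mul_succ_self _
  have hu : constantCoeff ((∏ i ∈ Finset.range (k + 1), (1 + X ^ (2 * i + 1))) *
      (1 + X ^ (2 * (k + 1))) : ℚ⟦X⟧) ≠ 0 := by
    simp [map_prod]
  rw [e1, e2, gapFreeTerm, map_mul, div_eq_mul_inv]
  congr 1
  refine (inv_eq_of_mul_eq_one_right ?_).symm
  rw [← map_mul, PowerSeries.mul_inv_cancel _ hu, map_one]

theorem sum_coeff_gapFreeTerm (n : ℕ) :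
    ∑ k ∈ Finset.range n, coeff n (gapFreeTerm k) =
      ∑ i ∈ Finset.range n, coeff n (heckeTerm i) := by
  rw [← map_sum, ← map_sum, ← sub_eq_zero, ← map_sub]
  have key : IsXPowMultiple (n + 1) (algebraMap ℚ⟦X⟧ (FractionRing ℚ⟦X⟧)
      (∑ k ∈ Finset.range n, gapFreeTerm k - ∑ i ∈ Finset.range n, heckeTerm i)) := by
    rw [map_sub, map_sum, map_sum]
    simp_rw [algebraMap_gapFreeTerm]
    rw [sum_product_eq_sum_invTheta negX_ne_zero negX_pow_ne_one]
    simp_rw [← algebraMap_heckeTerm]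
    rw [← Finset.sum_sub_distrib]
    refine IsXPowMultiple.sum _ _ fun i hi => ?_
    obtain ⟨d, rfl⟩ := Nat.exists_eq_add_of_lt (Finset.mem_range.1 hi)
    -- Here n = i + d + 1, so the kernel error has order only n; the additional factor X in
    -- `heckeTerm i` pushes the difference past the coefficient of X^n.
    rw [show i + d + 1 - i = d + 1 by omega, ← mul_sub_one]
    exact ((isXPowMultiple_heckeTerm i).mul
      (isXPowMultiple_sum_baileyKernel_sub_one i d)).mono (by omega)
  obtain ⟨f, hf⟩ := key
  rw [IsFractionRing.injective ℚ⟦X⟧ (FractionRing ℚ⟦X⟧) hf, coeff_X_pow_mul']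
  simp

end PowerSeries

/-! ### Signed partitions with parts in a finite set, with generating function ∏ 1/(1 + X^a) -/

section SignedCount

/-- The number of partitions of `n` with parts in `A`, signed by the number of parts. -/
def signedCount (A : Finset ℕ) (n : ℕ) : ℤ :=
  ∑ ν : n.Partition with ∀ m ∈ ν.parts, m ∈ A, (-1) ^ Multiset.card ν.parts

/-- Remove one appearance of the part `a`. -/
def Nat.Partition.erasePart {n : ℕ} (μ : n.Partition) (a : ℕ) (h : a ∈ μ.parts) :
    (n - a).Partition where
  parts := μ.parts.erase a
  parts_pos := fun hi => μ.parts_pos (Multiset.mem_of_mem_erase hi)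
  parts_sum := by
    have := congrArg Multiset.sum (Multiset.cons_erase h)
    rw [Multiset.sum_cons, μ.parts_sum] at this
    omega

/-- Add one appearance of the part `a`. -/
def Nat.Partition.consPart {n a : ℕ} (ha : 0 < a) (h : a ≤ n) (ν : (n - a).Partition) :
    n.Partition where
  parts := a ::ₘ ν.parts
  parts_pos := fun hi => by
    rcases Multiset.mem_cons.1 hi with rfl | hi
    · exact ha
    · exact ν.parts_pos hi
  parts_sum := by rw [Multiset.sum_cons, ν.parts_sum]; omega

/-- Removing one copy of a is a sign-reversing bijection from the partitions containing a. In
generating functions this is multiplication by 1 + X^a. -/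
lemma signedCount_insert {A : Finset ℕ} {a : ℕ} (ha : 0 < a) (haA : a ∉ A) (n : ℕ) :
    signedCount (insert a A) n + (if a ≤ n then signedCount (insert a A) (n - a) else 0) =
      signedCount A n := by
  have h1 : signedCount (insert a A) n =
      (∑ ν : n.Partition with (∀ m ∈ ν.parts, m ∈ insert a A) ∧ a ∈ ν.parts,
        (-1) ^ Multiset.card ν.parts) + signedCount A n := by
    rw [signedCount, ← Finset.sum_filter_add_sum_filter_not _ (fun ν => a ∈ ν.parts),
      Finset.filter_filter, Finset.filter_filter, signedCount]
    congr 2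
    ext ν
    simp only [Finset.mem_filter, Finset.mem_univ, true_and, Finset.mem_insert]
    constructor
    · rintro ⟨h, h'⟩ m hm
      exact (h m hm).resolve_left (fun e => h' (e ▸ hm))
    · exact fun h => ⟨fun m hm => Or.inr (h m hm), fun h' => haA (h a h')⟩
  have h2 : (∑ ν : n.Partition with (∀ m ∈ ν.parts, m ∈ insert a A) ∧ a ∈ ν.parts,
        (-1 : ℤ) ^ Multiset.card ν.parts) =
      - (if a ≤ n then signedCount (insert a A) (n - a) else 0) := by
    split_ifs with hn
    · rw [signedCount, ← Finset.sum_neg_distrib]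
      refine Finset.sum_bij' (fun ν h => ν.erasePart a (Finset.mem_filter.1 h).2.2)
        (fun ν _ => Nat.Partition.consPart ha hn ν) ?_ ?_ ?_ ?_ ?_
      · intro ν h
        simp only [Finset.mem_filter, Finset.mem_univ, true_and] at h ⊢
        exact fun m hm => h.1 m (Multiset.mem_of_mem_erase hm)
      · intro ν h
        simp only [Finset.mem_filter, Finset.mem_univ, true_and] at h ⊢
        refine ⟨fun m hm => ?_, Multiset.mem_cons_self _ _⟩
        rcases Multiset.mem_cons.1 hm with rfl | hm
        · exact Finset.mem_insert_self _ _
        · exact h m hm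
      · intro ν h
        exact Nat.Partition.ext (Multiset.cons_erase (Finset.mem_filter.1 h).2.2)
      · intro ν h
        exact Nat.Partition.ext (Multiset.erase_cons_head _ _)
      · intro ν h
        have := congrArg Multiset.card (Multiset.cons_erase (Finset.mem_filter.1 h).2.2)
        rw [Multiset.card_cons] at this
        simp only [Nat.Partition.erasePart]
        rw [← this, pow_succ]
        ring
    · rw [neg_zero]
      refine Finset.sum_eq_zero fun ν h => absurd ?_ hn
      rw [← ν.parts_sum]
      exact Multiset.single_le_sum (fun _ _ => Nat.zero_le _) _ (Finset.mem_filter.1 h).2.2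
  rw [h1, h2]
  ring

open PowerSeries

lemma signedCount_empty (n : ℕ) : signedCount ∅ n = if n = 0 then 1 else 0 := by
  rw [signedCount]
  split_ifs with hn
  · subst hn
    rw [Finset.filter_true_of_mem, Fintype.sum_unique]
    · simp [Subsingleton.elim (default : Nat.Partition 0) (Nat.Partition.ofSums 0 0 rfl),
        Nat.Partition.ofSums]
    · intro ν _ m hm
      simp at hm
  · refine Finset.sum_eq_zero fun ν h => absurd ?_ hn
    have h' : ν.parts = 0 :=
      Multiset.eq_zero_of_forall_notMem fun m hm => by simpa using (Finset.mem_filter.1 h).2 m hm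
    rw [← ν.parts_sum, h', Multiset.sum_zero]

lemma mk_signedCount_mul_prod (A : Finset ℕ) (hA : ∀ a ∈ A, 0 < a) :
    (PowerSeries.mk fun n => (signedCount A n : ℚ)) * ∏ a ∈ A, (1 + X ^ a) = 1 := by
  induction A using Finset.induction_on with
  | empty =>
    ext n
    simp [signedCount_empty, coeff_one]
  | insert a A haA ih =>
    rw [Finset.prod_insert haA, ← mul_assoc]
    refine Eq.trans ?_ (ih fun b hb => hA b (Finset.mem_insert_of_mem hb))
    congr 1
    ext n
    rw [mul_add, mul_one, map_add, coeff_mul_X_pow', coeff_mk, coeff_mk, coeff_mk,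
      ← signedCount_insert (hA a (Finset.mem_insert_self _ _)) haA n]
    split_ifs <;> simp

/-- The admissible parts of a gap-free partition with largest odd part `2 k + 1`. -/
def gapFreeParts (k : ℕ) : Finset ℕ :=
  insert (2 * (k + 1)) ((Finset.range (k + 1)).image fun i => 2 * i + 1)

lemma coeff_gapFreeTerm (n k : ℕ) : coeff n (gapFreeTerm k) =
    if (k + 1) ^ 2 ≤ n then (signedCount (gapFreeParts k) (n - (k + 1) ^ 2) : ℚ) else 0 := by
  have h := mk_signedCount_mul_prod (gapFreeParts k) (by
    intro a ha
    simp only [gapFreeParts, Finset.mem_insert, Finset.mem_image] at ha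
    omega)
  have hprod : ∏ a ∈ gapFreeParts k, (1 + X ^ a : ℚ⟦X⟧) =
      (∏ i ∈ Finset.range (k + 1), (1 + X ^ (2 * i + 1))) * (1 + X ^ (2 * (k + 1))) := by
    rw [gapFreeParts, Finset.prod_insert, Finset.prod_image, mul_comm]
    · intro i _ j _ hij
      simpa using hij
    · simp only [Finset.mem_image, not_exists, not_and]
      omega
  have hu : constantCoeff ((∏ i ∈ Finset.range (k + 1), (1 + X ^ (2 * i + 1))) *
      (1 + X ^ (2 * (k + 1))) : ℚ⟦X⟧) ≠ 0 := by
    simp [map_prod]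
  rw [hprod] at h
  rw [gapFreeTerm, ← (PowerSeries.eq_inv_iff_mul_eq_one hu).2 h, coeff_X_pow_mul', coeff_mk]

end SignedCount

/-! ### Identifying `p₁` with the coefficients of the q-series -/

section GapFree

/-- `IsGapFreeOdd` with prescribed largest odd part `2 k + 1`. -/
def IsGapFreeOddWith (k : ℕ) {n : ℕ} (μ : n.Partition) : Prop :=
  (∀ m : ℕ, Odd m → (m ∈ μ.parts ↔ m ≤ 2 * k + 1)) ∧
    ∀ m ∈ μ.parts, Even m → m = 2 * (k + 1)

/-- The multiset `{1, 3, …, 2 k + 1}`. -/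
def oddStaircase (k : ℕ) : Multiset ℕ := (Multiset.range (k + 1)).map fun i => 2 * i + 1

lemma mem_oddStaircase {k m : ℕ} : m ∈ oddStaircase k ↔ Odd m ∧ m ≤ 2 * k + 1 := by
  simp only [oddStaircase, Multiset.mem_map, Multiset.mem_range]
  constructor
  · rintro ⟨i, hi, rfl⟩
    exact ⟨⟨i, rfl⟩, by omega⟩
  · rintro ⟨⟨i, rfl⟩, h⟩
    exact ⟨i, by omega, rfl⟩

lemma sum_oddStaircase (k : ℕ) : (oddStaircase k).sum = (k + 1) ^ 2 := by
  change ∑ i ∈ Finset.range (k + 1), (2 * i + 1) = (k + 1) ^ 2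
  induction k with
  | zero => simp
  | succ k ih => rw [Finset.sum_range_succ, ih]; ring

lemma nodup_oddStaircase (k : ℕ) : (oddStaircase k).Nodup :=
  (Multiset.nodup_range _).map fun i j h => by simpa using h

lemma IsGapFreeOddWith.oddStaircase_le {k n : ℕ} {μ : n.Partition} (h : IsGapFreeOddWith k μ) :
    oddStaircase k ≤ μ.parts :=
  (Multiset.le_iff_subset (nodup_oddStaircase k)).2 fun m hm =>
    (h.1 m (mem_oddStaircase.1 hm).1).2 (mem_oddStaircase.1 hm).2

lemma mem_gapFreeParts {k m : ℕ} :
    m ∈ gapFreeParts k ↔ m = 2 * (k + 1) ∨ (Odd m ∧ m ≤ 2 * k + 1) := by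
  rw [← mem_oddStaircase]
  simp only [gapFreeParts, Finset.mem_insert, Finset.mem_image, Finset.mem_range, oddStaircase,
    Multiset.mem_map, Multiset.mem_range]

lemma IsGapFreeOddWith.mem_gapFreeParts {k n : ℕ} {μ : n.Partition} (h : IsGapFreeOddWith k μ)
    {m : ℕ} (hm : m ∈ μ.parts) : m ∈ gapFreeParts k := by
  rw [_root_.mem_gapFreeParts]
  rcases Nat.even_or_odd m with he | ho
  · exact Or.inl (h.2 m hm he)
  · exact Or.inr ⟨ho, (h.1 m ho).1 hm⟩

/-- The staircase consists of the first copy of each odd part, so what remains is the repeated odd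
parts together with all even parts. -/
lemma oddRepetitions_add_evenAppearances {k n : ℕ} {μ : n.Partition}
    (h : IsGapFreeOddWith k μ) :
    oddRepetitions μ + evenAppearances μ = Multiset.card (μ.parts - oddStaircase k) := by
  set ν := μ.parts - oddStaircase k with hν
  have hμ : μ.parts = ν + oddStaircase k := (tsub_add_cancel_of_le h.oddStaircase_le).symm
  have h1 : evenAppearances μ = ν.countP (fun m => Even m) := by
    rw [evenAppearances, hμ, Multiset.countP_add]
    have : (oddStaircase k).countP (fun m => Even m) = 0 :=
      Multiset.countP_eq_zero.2 fun m hm =>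
        Nat.not_even_iff_odd.2 (mem_oddStaircase.1 hm).1
    omega
  have h2 : oddRepetitions μ = ν.countP (fun m => ¬ Even m) := by
    rw [oddRepetitions, Multiset.countP_eq_card_filter, ← Multiset.sum_count_eq_card
      (s := μ.parts.toFinset.filter (fun m => Odd m))]
    · refine Finset.sum_congr rfl fun m hm => ?_
      obtain ⟨hm1, hm2⟩ := Finset.mem_filter.1 hm
      have hm3 : m ∈ oddStaircase k :=
        mem_oddStaircase.2 ⟨hm2, (h.1 m hm2).1 (Multiset.mem_toFinset.1 hm1)⟩
      rw [Multiset.count_filter_of_pos (p := fun m => ¬ Even m) (Nat.not_even_iff_odd.2 hm2), hμ, Multiset.count_add,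
        Multiset.count_eq_one_of_mem (nodup_oddStaircase k) hm3]
      omega
    · intro m hm
      obtain ⟨hm1, hm2⟩ := Multiset.mem_filter.1 hm
      refine Finset.mem_filter.2 ⟨Multiset.mem_toFinset.2 ?_, Nat.not_even_iff_odd.1 hm2⟩
      rw [hμ]
      exact Multiset.mem_add.2 (Or.inl hm1)
  rw [h1, h2, add_comm, ← Multiset.card_eq_countP_add_countP]

open Classical in
lemma sum_isGapFreeOddWith (k n : ℕ) :
    ∑ μ : n.Partition with IsGapFreeOddWith k μ,
      (-1 : ℤ) ^ (oddRepetitions μ + evenAppearances μ) =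
    if (k + 1) ^ 2 ≤ n then signedCount (gapFreeParts k) (n - (k + 1) ^ 2) else 0 := by
  split_ifs with hn
  · rw [signedCount]
    refine Finset.sum_bij'
      (fun μ h => ⟨μ.parts - oddStaircase k,
        fun hi => μ.parts_pos (Multiset.mem_of_le tsub_le_self hi), ?_⟩)
      (fun ν _ => ⟨ν.parts + oddStaircase k, ?_, ?_⟩) ?_ ?_ ?_ ?_ ?_
    · have h' := (Finset.mem_filter.1 h).2.oddStaircase_le
      have := congrArg Multiset.sum (tsub_add_cancel_of_le h')
      rw [Multiset.sum_add, sum_oddStaircase, μ.parts_sum] at this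
      omega
    · intro i hi
      rcases Multiset.mem_add.1 hi with hi | hi
      · exact ν.parts_pos hi
      · exact (mem_oddStaircase.1 hi).1.pos
    · rw [Multiset.sum_add, sum_oddStaircase, ν.parts_sum]
      omega
    · intro μ h
      simp only [Finset.mem_filter, Finset.mem_univ, true_and] at h ⊢
      exact fun m hm => h.mem_gapFreeParts (Multiset.mem_of_le tsub_le_self hm)
    · intro ν h
      simp only [Finset.mem_filter, Finset.mem_univ, true_and] at h ⊢
      refine ⟨fun m hm => ⟨fun h' => ?_, fun h' =>
        Multiset.mem_add.2 (Or.inr (mem_oddStaircase.2 ⟨hm, h'⟩))⟩, fun m hm he => ?_⟩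
      · rcases Multiset.mem_add.1 h' with h' | h'
        · rcases mem_gapFreeParts.1 (h m h') with rfl | h''
          · exact absurd hm (Nat.not_odd_iff_even.2 (even_two_mul _))
          · exact h''.2
        · exact (mem_oddStaircase.1 h').2
      · rcases Multiset.mem_add.1 hm with h' | h'
        · rcases mem_gapFreeParts.1 (h m h') with h'' | h''
          · exact h''
          · exact absurd h''.1 (Nat.not_odd_iff_even.2 he)
        · exact absurd (mem_oddStaircase.1 h').1 (Nat.not_odd_iff_even.2 he)
    · intro μ h
      exact Nat.Partition.ext (tsub_add_cancel_of_le (Finset.mem_filter.1 h).2.oddStaircase_le)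
    · intro ν h
      exact Nat.Partition.ext Multiset.add_sub_cancel_right
    · intro μ h
      rw [oddRepetitions_add_evenAppearances (Finset.mem_filter.1 h).2]
  · refine Finset.sum_eq_zero fun μ h => absurd ?_ hn
    have h' := (Finset.mem_filter.1 h).2.oddStaircase_le
    have := congrArg Multiset.sum (tsub_add_cancel_of_le h')
    rw [Multiset.sum_add, sum_oddStaircase, μ.parts_sum] at this
    omega

lemma isGapFreeOdd_iff {n : ℕ} (μ : n.Partition) :
    IsGapFreeOdd μ ↔ ∃ k, IsGapFreeOddWith k μ := by
  constructor
  · rintro ⟨L, ⟨k, rfl⟩, h1, h2⟩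
    exact ⟨k, h1, h2⟩
  · rintro ⟨k, h1, h2⟩
    exact ⟨2 * k + 1, ⟨k, rfl⟩, h1, h2⟩

lemma IsGapFreeOddWith.unique {k l n : ℕ} {μ : n.Partition} (hk : IsGapFreeOddWith k μ)
    (hl : IsGapFreeOddWith l μ) : k = l := by
  have h1 := (hl.1 _ ⟨k, rfl⟩).1 ((hk.1 _ ⟨k, rfl⟩).2 le_rfl)
  have h2 := (hk.1 _ ⟨l, rfl⟩).1 ((hl.1 _ ⟨l, rfl⟩).2 le_rfl)
  omega

lemma IsGapFreeOddWith.lt {k n : ℕ} {μ : n.Partition} (hk : IsGapFreeOddWith k μ) : k < n := by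
  have h1 := Multiset.single_le_sum (fun _ _ => Nat.zero_le _) _ ((hk.1 _ ⟨k, rfl⟩).2 le_rfl)
  rw [μ.parts_sum] at h1
  omega

open Classical in
lemma p₁_eq_sum_signedCount (n : ℕ) : p₁ n = ∑ k ∈ Finset.range n,
    if (k + 1) ^ 2 ≤ n then signedCount (gapFreeParts k) (n - (k + 1) ^ 2) else 0 := by
  simp_rw [← sum_isGapFreeOddWith]
  rw [p₁, ← Finset.sum_biUnion]
  · refine Finset.sum_congr ?_ fun _ _ => rfl
    ext μ
    simp only [Finset.mem_filter, Finset.mem_univ, true_and, Finset.mem_biUnion,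
      Finset.mem_range, isGapFreeOdd_iff]
    exact ⟨fun ⟨k, hk⟩ => ⟨k, hk.lt, hk⟩, fun ⟨k, _, hk⟩ => ⟨k, hk⟩⟩
  · intro k _ l _ hkl
    refine Finset.disjoint_left.2 fun μ h1 h2 => hkl ?_
    exact (Finset.mem_filter.1 h1).2.unique (Finset.mem_filter.1 h2).2

open PowerSeries in
/-- The weighted count of gap-free partitions as a coefficient of an indefinite theta series. -/
theorem p₁_eq_sum_coeff_heckeTerm (n : ℕ) :
    (p₁ n : ℚ) = ∑ i ∈ Finset.range n, coeff n (heckeTerm i) := by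
  rw [← sum_coeff_gapFreeTerm, p₁_eq_sum_signedCount]
  push_cast
  refine Finset.sum_congr rfl fun k _ => ?_
  rw [coeff_gapFreeTerm]

end GapFree

/-! ### Bounds from the indefinite theta series: support of `p₁` and the first estimate -/

section Bounds

open PowerSeries

lemma coeff_neg_X_pow (n e : ℕ) :
    coeff n ((-X : ℚ⟦X⟧) ^ e) = if n = e then (-1) ^ e else 0 := by
  rw [neg_pow, show (-1 : ℚ⟦X⟧) ^ e = C ((-1) ^ e) by simp, coeff_C_mul, coeff_X_pow]
  simp

lemma coeff_heckeTerm (n i : ℕ) : coeff n (heckeTerm i) =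
    (-1) ^ (i + 1) * ∑ l ∈ Finset.range (i + 1),
      ((if n = 2 * (i + 1) ^ 2 - (l + 1) ^ 2 then (-1) ^ (2 * (i + 1) ^ 2 - (l + 1) ^ 2) else 0) +
        if n = 2 * (i + 1) ^ 2 - l ^ 2 then (-1) ^ (2 * (i + 1) ^ 2 - l ^ 2) else 0) := by
  rw [heckeTerm, show (-1 : ℚ⟦X⟧) ^ (i + 1) = C ((-1) ^ (i + 1)) by simp, coeff_C_mul, map_sum]
  simp_rw [map_add, coeff_neg_X_pow]

lemma exists_eq_of_p₁_ne_zero {n : ℕ} (h : p₁ n ≠ 0) :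
    ∃ r j : ℕ, 0 < r ∧ j ≤ r ∧ n + j ^ 2 = 2 * r ^ 2 := by
  have h' : (p₁ n : ℚ) ≠ 0 := by exact_mod_cast h
  rw [p₁_eq_sum_coeff_heckeTerm] at h'
  obtain ⟨i, _, hi⟩ := Finset.exists_ne_zero_of_sum_ne_zero h'
  rw [coeff_heckeTerm] at hi
  obtain ⟨l, hl, hl'⟩ := Finset.exists_ne_zero_of_sum_ne_zero (right_ne_zero_of_mul hi)
  have hl := Finset.mem_range.1 hl
  have e1 : (l + 1) ^ 2 ≤ 2 * (i + 1) ^ 2 := by nlinarith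
  have e2 : l ^ 2 ≤ 2 * (i + 1) ^ 2 := by nlinarith
  by_cases h1 : n = 2 * (i + 1) ^ 2 - (l + 1) ^ 2
  · exact ⟨i + 1, l + 1, by omega, by omega, by omega⟩
  · by_cases h2 : n = 2 * (i + 1) ^ 2 - l ^ 2
    · exact ⟨i + 1, l, by omega, by omega, by omega⟩
    · simp [h1, h2] at hl'

lemma abs_p₁_le (n : ℕ) : |(p₁ n : ℝ)| ≤ ∑ i ∈ Finset.range n, ∑ l ∈ Finset.range (i + 1),
    ((if n = 2 * (i + 1) ^ 2 - (l + 1) ^ 2 then (1 : ℝ) else 0) +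
      if n = 2 * (i + 1) ^ 2 - l ^ 2 then 1 else 0) := by
  have h : |(p₁ n : ℚ)| ≤ ∑ i ∈ Finset.range n, ∑ l ∈ Finset.range (i + 1),
    ((if n = 2 * (i + 1) ^ 2 - (l + 1) ^ 2 then (1 : ℚ) else 0) +
      if n = 2 * (i + 1) ^ 2 - l ^ 2 then 1 else 0) := by
    rw [p₁_eq_sum_coeff_heckeTerm]
    refine (Finset.abs_sum_le_sum_abs _ _).trans (Finset.sum_le_sum fun i _ => ?_)
    rw [coeff_heckeTerm, abs_mul, abs_pow, abs_neg, abs_one, one_pow, one_mul]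
    refine (Finset.abs_sum_le_sum_abs _ _).trans (Finset.sum_le_sum fun l _ => ?_)
    refine (abs_add_le _ _).trans (add_le_add ?_ ?_) <;> split_ifs <;> simp
  exact_mod_cast h

/-- There are 2i + 1 integers m with i² ≤ m < (i + 1)², and each satisfies z^m ≥ z^((i+1)²). -/
lemma sum_odd_mul_pow_sq_le {z : ℝ} (h0 : 0 ≤ z) (h1 : z ≤ 1) (N : ℕ) :
    ∑ i ∈ Finset.range N, (2 * i + 1 : ℝ) * z ^ (i + 1) ^ 2 ≤
      ∑ m ∈ Finset.range (N ^ 2), z ^ m := by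
  induction N with
  | zero => simp
  | succ N ih =>
    rw [Finset.sum_range_succ, show (N + 1) ^ 2 = N ^ 2 + (2 * N + 1) by ring,
      Finset.sum_range_add]
    refine add_le_add ih ?_
    rw [show (2 * N + 1 : ℝ) * z ^ (N ^ 2 + (2 * N + 1)) =
      ∑ _m ∈ Finset.range (2 * N + 1), z ^ (N ^ 2 + (2 * N + 1)) by simp]
    exact Finset.sum_le_sum fun m hm =>
      pow_le_pow_of_le_one h0 h1 (by have := Finset.mem_range.1 hm; omega)

/-- With r = i + 1 and |j| ≤ r, every exponent 2r² - j² is at least r², so the 2r terms for r give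
at most 2r z^(r²) ≤ 2(2i + 1) z^((i+1)²), which is compared with a geometric series. -/
lemma sum_abs_p₁_mul_pow_le {z : ℝ} (h0 : 0 < z) (h1 : z < 1) (N : ℕ) :
    ∑ n ∈ Finset.range N, |(p₁ n : ℝ)| * z ^ n ≤ 2 / (1 - z) := by
  have hz : ∀ e i : ℕ, (i + 1) ^ 2 ≤ e →
      ∑ n ∈ Finset.range N, (if n = e then (1 : ℝ) else 0) * z ^ n ≤ z ^ (i + 1) ^ 2 := by
    intro e i he
    simp only [ite_mul, one_mul, zero_mul, Finset.sum_ite_eq']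
    split_ifs
    · exact pow_le_pow_of_le_one h0.le h1.le he
    · positivity
  calc ∑ n ∈ Finset.range N, |(p₁ n : ℝ)| * z ^ n
      ≤ ∑ n ∈ Finset.range N, ∑ i ∈ Finset.range N, ∑ l ∈ Finset.range (i + 1),
        ((if n = 2 * (i + 1) ^ 2 - (l + 1) ^ 2 then (1 : ℝ) else 0) +
          if n = 2 * (i + 1) ^ 2 - l ^ 2 then 1 else 0) * z ^ n := by
        refine Finset.sum_le_sum fun n hn => ?_
        simp_rw [← Finset.sum_mul]
        refine mul_le_mul_of_nonneg_right ((abs_p₁_le n).trans ?_) (by positivity)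
        refine Finset.sum_le_sum_of_subset_of_nonneg
          (Finset.range_mono (Finset.mem_range.1 hn).le) fun i _ _ => ?_
        refine Finset.sum_nonneg fun l _ => ?_
        split_ifs <;> norm_num
    _ = ∑ i ∈ Finset.range N, ∑ l ∈ Finset.range (i + 1), ∑ n ∈ Finset.range N,
        ((if n = 2 * (i + 1) ^ 2 - (l + 1) ^ 2 then (1 : ℝ) else 0) +
          if n = 2 * (i + 1) ^ 2 - l ^ 2 then 1 else 0) * z ^ n := by
        rw [Finset.sum_comm]
        refine Finset.sum_congr rfl fun i _ => Finset.sum_comm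
    _ ≤ ∑ i ∈ Finset.range N, ∑ l ∈ Finset.range (i + 1), 2 * z ^ (i + 1) ^ 2 := by
        refine Finset.sum_le_sum fun i _ => Finset.sum_le_sum fun l hl => ?_
        have hl := Finset.mem_range.1 hl
        have e1 : (l + 1) ^ 2 ≤ (i + 1) ^ 2 := Nat.pow_le_pow_left (by omega) 2
        have e2 : l ^ 2 ≤ (i + 1) ^ 2 := Nat.pow_le_pow_left (by omega) 2
        simp_rw [add_mul]
        rw [Finset.sum_add_distrib]
        exact (add_le_add (hz (2 * (i + 1) ^ 2 - (l + 1) ^ 2) i (by omega))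
          (hz (2 * (i + 1) ^ 2 - l ^ 2) i (by omega))).trans_eq (two_mul _).symm
    _ ≤ ∑ i ∈ Finset.range N, 2 * ((2 * i + 1 : ℝ) * z ^ (i + 1) ^ 2) := by
        refine Finset.sum_le_sum fun i _ => ?_
        rw [Finset.sum_const, Finset.card_range, nsmul_eq_mul]
        push_cast
        have : 0 ≤ z ^ (i + 1) ^ 2 := by positivity
        have hi : (0 : ℝ) ≤ i := by positivity
        nlinarith [mul_nonneg hi this]
    _ ≤ 2 * (1 - z)⁻¹ := by
        rw [← Finset.mul_sum]
        refine mul_le_mul_of_nonneg_left ?_ zero_le_two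
        refine (sum_odd_mul_pow_sq_le h0.le h1.le N).trans ?_
        rw [← tsum_geometric_of_lt_one h0.le h1]
        exact (summable_geometric_of_lt_one h0.le h1).sum_le_tsum _ fun _ _ => by positivity
    _ = 2 / (1 - z) := by rw [div_eq_mul_inv]

lemma summable_abs_p₁_mul_pow {z : ℝ} (h0 : 0 < z) (h1 : z < 1) :
    Summable fun n : ℕ => |(p₁ n : ℝ)| * z ^ n :=
  summable_of_sum_range_le (fun _ => by positivity) (sum_abs_p₁_mul_pow_le h0 h1)

lemma summable_p₁_mul_pow {z : ℝ} (h0 : 0 < z) (h1 : z < 1) :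
    Summable fun n : ℕ+ => (p₁ n : ℝ) * z ^ (n : ℕ) := by
  have h : Summable fun n : ℕ => (p₁ n : ℝ) * z ^ n := by
    refine Summable.of_norm ?_
    simpa [abs_of_pos h0] using summable_abs_p₁_mul_pow h0 h1
  exact h.comp_injective PNat.coe_injective

lemma abs_tsum_p₁_mul_pow_le {z : ℝ} (h0 : 0 < z) (h1 : z < 1) :
    |∑' n : ℕ+, (p₁ n : ℝ) * z ^ (n : ℕ)| ≤ 2 / (1 - z) := by
  have h := summable_abs_p₁_mul_pow h0 h1
  have h' : Summable fun n : ℕ+ => |(p₁ n : ℝ)| * z ^ (n : ℕ) :=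
    h.comp_injective PNat.coe_injective
  have e : ∀ n : ℕ+, ‖(p₁ n : ℝ) * z ^ (n : ℕ)‖ = |(p₁ n : ℝ)| * z ^ (n : ℕ) := fun n => by
    simp [abs_of_pos h0]
  rw [← Real.norm_eq_abs]
  refine (norm_tsum_le_tsum_norm (by simpa only [e] using h')).trans ?_
  simp_rw [e]
  refine (tsum_comp_le_tsum_of_inj h (fun _ => by positivity) PNat.coe_injective).trans ?_
  exact Real.tsum_le_of_sum_range_le (fun _ => by positivity) (sum_abs_p₁_mul_pow_le h0 h1)

theorem isBigO_tsum_p₁ : (fun z : ℝ => ∑' n : ℕ+, (p₁ n : ℝ) * z ^ (n : ℕ))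
    =O[𝓝[<] (1 : ℝ)] (fun z : ℝ => 1 / (1 - z)) := by
  refine IsBigO.of_bound 2 ?_
  filter_upwards [Ioo_mem_nhdsLT (zero_lt_one' ℝ)] with z hz
  have h : 0 < 1 - z := sub_pos.2 hz.2
  rw [Real.norm_eq_abs, Real.norm_eq_abs, abs_of_pos (by positivity : 0 < 1 / (1 - z))]
  exact (abs_tsum_p₁_mul_pow_le hz.1 hz.2).trans_eq (by ring)

end Bounds

/-! ### Values of 2r² - j² and the Dirichlet series ζ(s)L(s, χ₈) -/

section Arithmetic

/-- Every prime factor of the nonzero number `n` is `2` or splits in `ℚ(√2)`. -/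
def IsTwoSplit (n : ℕ) : Prop :=
  n ≠ 0 ∧ ∀ p : ℕ, p.Prime → p ∣ n → p = 2 ∨ p % 8 = 1 ∨ p % 8 = 7

lemma IsTwoSplit.of_dvd {m n : ℕ} (hn : IsTwoSplit n) (h : m ∣ n) : IsTwoSplit m :=
  ⟨fun h0 => hn.1 (by simpa [h0] using h), fun p hp hpm => hn.2 p hp (hpm.trans h)⟩

/-- Modulo an odd prime p dividing k, j² = 2r². Coprimality makes r invertible, so 2 = (j/r)² is a
square, which forces p ≡ ±1 mod 8. -/
lemma isTwoSplit_of_coprime {k r j : ℕ} (hk : k ≠ 0) (h : k + j ^ 2 = 2 * r ^ 2)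
    (hc : Nat.Coprime r j) : IsTwoSplit k := by
  refine ⟨hk, fun p hp hpk => or_iff_not_imp_left.2 fun hp2 => ?_⟩
  have : Fact p.Prime := ⟨hp⟩
  rw [← ZMod.exists_sq_eq_two_iff hp2]
  have h1 : ((j : ZMod p)) ^ 2 = 2 * (r : ZMod p) ^ 2 := by
    have := congrArg (Nat.cast (R := ZMod p)) h
    push_cast at this
    rwa [(ZMod.natCast_eq_zero_iff k p).2 hpk, zero_add] at this
  have hr : (r : ZMod p) ≠ 0 := by
    intro hr
    rw [hr] at h1
    have hj : (j : ZMod p) = 0 := by simpa using h1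
    rw [ZMod.natCast_eq_zero_iff] at hr hj
    exact Nat.not_coprime_of_dvd_of_dvd hp.one_lt hr hj hc
  refine ⟨(j : ZMod p) / r, ?_⟩
  field_simp
  linear_combination -h1

lemma exists_sq_mul_isTwoSplit {n r j : ℕ} (hn : n ≠ 0) (hr : 0 < r)
    (h : n + j ^ 2 = 2 * r ^ 2) : ∃ g k : ℕ, 0 < g ∧ n = g ^ 2 * k ∧ IsTwoSplit k := by
  obtain ⟨r', j', hc, hr', hj'⟩ := Nat.exists_coprime r j
  set g := Nat.gcd r j with hg
  have hg0 : 0 < g := Nat.gcd_pos_of_pos_left _ hr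
  have hdvd : g ^ 2 ∣ n := by
    have h1 : g ^ 2 ∣ n + j ^ 2 := by
      rw [h, hr']
      exact ⟨2 * r' ^ 2, by ring⟩
    refine (Nat.dvd_add_left ?_).1 h1
    rw [hj']
    exact ⟨j' ^ 2, by ring⟩
  obtain ⟨k, hk⟩ := hdvd
  refine ⟨g, k, hg0, hk, isTwoSplit_of_coprime (r := r') (j := j') ?_ ?_ hc⟩
  · rintro rfl
    exact hn (by simpa using hk)
  · have : g ^ 2 * (k + j' ^ 2) = g ^ 2 * (2 * r' ^ 2) := by
      rw [hk, hr', hj'] at h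
      linarith
    exact Nat.eq_of_mul_eq_mul_left (by positivity) this

/-- The quadratic Dirichlet character of `ℚ(√2)` with complex values. -/
noncomputable def chiEight : DirichletCharacter ℂ 8 :=
  ZMod.χ₈.ringHomComp (Int.castRingHom ℂ)

lemma chiEight_sq : chiEight ^ 2 = 1 :=
  MulChar.isQuadratic_iff_sq_eq_one.1 (ZMod.isQuadratic_χ₈.comp _)

lemma chiEight_natCast (n : ℕ) : chiEight n = ((ZMod.χ₈ n : ℤ) : ℂ) := by
  simp [chiEight, MulChar.ringHomComp_apply]

lemma chiEight_ne_one : chiEight ≠ 1 := by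
  intro h
  have h3 := chiEight_natCast 3
  rw [h, ZMod.χ₈_nat_eq_if_mod_eight] at h3
  have : (1 : DirichletCharacter ℂ 8) ((3 : ℕ) : ZMod 8) = 1 :=
    MulChar.one_apply ((ZMod.isUnit_iff_coprime 3 8).2 (by norm_num))
  rw [this] at h3
  norm_num at h3

lemma chiEight_eq_one {n : ℕ} (h : IsTwoSplit n) (ho : ¬ 2 ∣ n) : chiEight n = 1 := by
  induction n using Nat.recOnMul with
  | zero => exact absurd rfl h.1
  | one => simp
  | prime p hp =>
    rw [chiEight_natCast, ZMod.χ₈_nat_eq_if_mod_eight]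
    rcases h.2 p hp dvd_rfl with h2 | h2
    · exact absurd (by rw [h2]) ho
    · have : p % 2 ≠ 0 := by omega
      simp [h2, this]
  | mul a b iha ihb =>
    push_cast
    rw [map_mul, iha (h.of_dvd (Dvd.intro _ rfl)) fun h' => ho (h'.mul_right _),
      ihb (h.of_dvd (Dvd.intro_left _ rfl)) fun h' => ho (h'.mul_left _), one_mul]

lemma zetaMul_chiEight {n : ℕ} (h : IsTwoSplit n) (ho : ¬ 2 ∣ n) :
    chiEight.zetaMul n = (n.divisors.card : ℂ) := by
  rw [DirichletCharacter.zetaMul, ArithmeticFunction.coe_zeta_mul_apply]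
  rw [Finset.sum_congr rfl (g := fun _ => (1 : ℂ)), Finset.sum_const, nsmul_eq_mul, mul_one]
  intro d hd
  have hd' := Nat.dvd_of_mem_divisors hd
  have hd0 : d ≠ 0 := (h.of_dvd hd').1
  rw [← chiEight.apply_eq_toArithmeticFunction_apply hd0]
  exact chiEight_eq_one (h.of_dvd hd') fun h' => ho (h'.trans hd')

lemma IsTwoSplit.mul {m n : ℕ} (hm : IsTwoSplit m) (hn : IsTwoSplit n) : IsTwoSplit (m * n) :=
  ⟨mul_ne_zero hm.1 hn.1, fun p hp h =>
    ((Nat.Prime.dvd_mul hp).1 h).elim (hm.2 p hp) (hn.2 p hp)⟩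

lemma LSeries_zetaMul_chiEight {s : ℂ} (hs : 1 < s.re) :
    LSeries chiEight.zetaMul s = riemannZeta s * chiEight.LFunction s := by
  rw [DirichletCharacter.zetaMul, ← ArithmeticFunction.coe_mul, LSeries_convolution',
    chiEight.LFunction_eq_LSeries hs]
  · congr 1
    · simp_rw [← ArithmeticFunction.LSeries_zeta_eq_riemannZeta hs,
        ← ArithmeticFunction.natCoe_apply]
    · exact (LSeries_congr chiEight.apply_eq_toArithmeticFunction_apply s).symm
  · exact ArithmeticFunction.LSeriesSummable_zeta_iff.mpr hs
  · exact (LSeriesSummable_congr _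
      fun h => (chiEight.apply_eq_toArithmeticFunction_apply h).symm).mpr <|
      ZMod.LSeriesSummable_of_one_lt_re chiEight hs

/-- In the expanded square, n^(-s) occurs once per pair (a, b) with ab = n, hence at most d(n)
times. For n odd and split, χ₈ is 1 on every divisor, so d(n) is exactly the coefficient (1 *
χ₈)(n); all other coefficients are nonnegative because the character is quadratic. -/
lemma sq_sum_rpow_le_norm_LSeries {s : ℝ} (hs : 1 < s) (F : Finset ℕ)
    (hF : ∀ a ∈ F, IsTwoSplit a ∧ ¬ 2 ∣ a) :
    (∑ a ∈ F, (a : ℝ) ^ (-s)) ^ 2 ≤ ‖LSeries chiEight.zetaMul s‖ := by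
  set t : ℕ → ℝ := fun n => (chiEight.zetaMul n).re * (n : ℝ) ^ (-s) with ht
  have hnn : ∀ n, 0 ≤ (chiEight.zetaMul n).re := fun n =>
    (Complex.le_def.1 (DirichletCharacter.zetaMul_nonneg chiEight_sq n)).1
  have htn : ∀ n, 0 ≤ t n := fun n => mul_nonneg (hnn n) (by positivity)
  have hterm : ∀ n, LSeries.term chiEight.zetaMul s n = (t n : ℂ) := by
    intro n
    rcases eq_or_ne n 0 with rfl | hn
    · simp [ht]
    · rw [LSeries.term_of_ne_zero hn, ht]
      have him : (chiEight.zetaMul n) = ((chiEight.zetaMul n).re : ℂ) := by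
        apply Complex.ext
        · simp
        · simpa using (Complex.le_def.1 (DirichletCharacter.zetaMul_nonneg chiEight_sq n)).2.symm
      push_cast
      rw [← him, Complex.ofReal_cpow (by positivity), div_eq_mul_inv, ← Complex.cpow_neg]
      push_cast
      rfl
  have hsum : Summable t := by
    have h1 := chiEight.LSeriesSummable_zetaMul (s := (s : ℂ)) (by simpa using hs)
    rw [LSeriesSummable, show LSeries.term chiEight.zetaMul s = fun n => (t n : ℂ) from
      funext hterm] at h1
    exact Complex.summable_ofReal.1 h1
  have hL : ‖LSeries chiEight.zetaMul s‖ = ∑' n, t n := by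
    rw [LSeries, tsum_congr hterm, ← Complex.ofReal_tsum, Complex.norm_real, Real.norm_eq_abs,
      abs_of_nonneg (tsum_nonneg htn)]
  rw [hL, sq, Finset.sum_mul_sum, ← Finset.sum_product']
  rw [← Finset.sum_fiberwise_of_maps_to (t := (F ×ˢ F).image fun x => x.1 * x.2)
    (g := fun x => x.1 * x.2) fun x hx => Finset.mem_image_of_mem _ hx]
  refine (Finset.sum_le_sum fun n hn => ?_).trans (hsum.sum_le_tsum _ fun n _ => htn n)
  obtain ⟨⟨a, b⟩, hab, rfl⟩ := Finset.mem_image.1 hn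
  obtain ⟨ha, hb⟩ := Finset.mem_product.1 hab
  have hsplit := (hF a ha).1.mul (hF b hb).1
  have hodd : ¬ 2 ∣ a * b := fun h =>
    ((Nat.Prime.dvd_mul Nat.prime_two).1 h).elim (hF a ha).2 (hF b hb).2
  simp only [ht]
  rw [zetaMul_chiEight hsplit hodd, Complex.natCast_re, ← nsmul_eq_mul]
  refine (Finset.sum_le_card_nsmul _ _ (((a * b : ℕ) : ℝ) ^ (-s)) ?_).trans
    (nsmul_le_nsmul_left (by positivity) ?_)
  · rintro ⟨c, d⟩ hcd
    have := (Finset.mem_filter.1 hcd).2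
    simp only at this
    rw [← this, Nat.cast_mul, Real.mul_rpow (by positivity) (by positivity)]
  · refine Finset.card_le_card_of_injOn (fun x => x.1) ?_ ?_
    · rintro ⟨c, d⟩ hcd
      have := (Finset.mem_filter.1 hcd).2
      simp only at this
      simp only [Finset.mem_coe, Nat.mem_divisors]
      exact ⟨Dvd.intro _ this, hsplit.1⟩
    · rintro ⟨c, d⟩ hcd ⟨c', d'⟩ hcd' h
      have h1 := (Finset.mem_filter.1 hcd).2
      have h2 := (Finset.mem_filter.1 hcd').2
      simp only at h1 h2 h
      subst h
      have hc : 0 < c := Nat.pos_of_ne_zero fun h0 => hsplit.1 (by rw [← h1, h0, zero_mul])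
      rw [Nat.eq_of_mul_eq_mul_left hc (h1.trans h2.symm)]

/-- ζ has a simple pole at 1 and L(s, χ₈) is entire, so (s - 1) times the product stays bounded.
Nonvanishing of L(1, χ₈) is not needed for an upper bound. -/
lemma exists_norm_LSeries_le : ∃ C : ℝ, 0 < C ∧ ∀ᶠ s : ℝ in 𝓝[>] 1,
    ‖LSeries chiEight.zetaMul s‖ ≤ C / (s - 1) := by
  have h1 : Tendsto (fun s : ℂ => (s - 1) * riemannZeta s * chiEight.LFunction s) (𝓝[≠] 1)
      (𝓝 (1 * chiEight.LFunction 1)) :=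
    riemannZeta_residue_one.mul
      ((DirichletCharacter.differentiable_LFunction chiEight_ne_one).continuous.tendsto 1 |>.mono_left
        nhdsWithin_le_nhds)
  have h2 : Tendsto (fun s : ℝ => (s : ℂ)) (𝓝[>] 1) (𝓝[≠] 1) := by
    refine tendsto_nhdsWithin_iff.2 ⟨?_, ?_⟩
    · exact (Complex.continuous_ofReal.tendsto' 1 1 (by simp)).mono_left nhdsWithin_le_nhds
    · filter_upwards [self_mem_nhdsWithin] with s hs
      simpa using (ne_of_gt hs : s ≠ 1)
  have h3 := (h1.comp h2).norm
  refine ⟨‖1 * chiEight.LFunction 1‖ + 1, by positivity, ?_⟩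
  filter_upwards [h3.eventually_le_const (lt_add_one _), self_mem_nhdsWithin] with s hs hs1
  have hs1 : 1 < s := hs1
  rw [LSeries_zetaMul_chiEight (by simpa using hs1), le_div_iff₀ (by linarith)]
  refine le_trans (le_of_eq ?_) hs
  simp only [Function.comp, norm_mul]
  rw [show ((s : ℂ) - 1) = ((s - 1 : ℝ) : ℂ) by push_cast; ring, Complex.norm_real,
    Real.norm_eq_abs, abs_of_pos (by linarith)]
  ring

end Arithmetic

/-! ### Counting the support: O(N/√log N) -/

section Counting

open Classical in
/-- The positive integers up to `N` all of whose prime factors are `2` or split in `ℚ(√2)`. -/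
noncomputable def twoSplitUpTo (N : ℕ) : Finset ℕ := (Finset.Ioc 0 N).filter IsTwoSplit

lemma mem_twoSplitUpTo {N n : ℕ} : n ∈ twoSplitUpTo N ↔ n ≤ N ∧ IsTwoSplit n := by
  simp only [twoSplitUpTo, Finset.mem_filter, Finset.mem_Ioc]
  exact ⟨fun h => ⟨h.1.2, h.2⟩, fun h => ⟨⟨Nat.pos_of_ne_zero h.2.1, h.1⟩, h.2⟩⟩

/-- Halving maps the even members into the set, and 2^(-s) ≤ 1/2, so they carry at most half of the
sum. This reduces to odd members, where the character applies. -/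
lemma sum_rpow_twoSplit_le {s : ℝ} (hs : 1 < s) (N : ℕ) :
    ∑ n ∈ twoSplitUpTo N, (n : ℝ) ^ (-s) ≤
      2 * ∑ n ∈ twoSplitUpTo N with ¬ 2 ∣ n, (n : ℝ) ^ (-s) := by
  have h1 : ∑ n ∈ twoSplitUpTo N with 2 ∣ n, (n : ℝ) ^ (-s) ≤
      1 / 2 * ∑ n ∈ twoSplitUpTo N, (n : ℝ) ^ (-s) := by
    calc ∑ n ∈ twoSplitUpTo N with 2 ∣ n, (n : ℝ) ^ (-s)
        ≤ ∑ n ∈ (twoSplitUpTo N).image (fun m : ℕ => (2 * m : ℕ)), (n : ℝ) ^ (-s) := by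
          refine Finset.sum_le_sum_of_subset_of_nonneg ?_ fun _ _ _ => by positivity
          intro n hn
          obtain ⟨hn, m, rfl⟩ := Finset.mem_filter.1 hn
          obtain ⟨h2, h3⟩ := mem_twoSplitUpTo.1 hn
          exact Finset.mem_image.2 ⟨m, mem_twoSplitUpTo.2
            ⟨by omega, h3.of_dvd (Dvd.intro_left _ rfl)⟩, rfl⟩
      _ = ∑ m ∈ twoSplitUpTo N, ((2 * m : ℕ) : ℝ) ^ (-s) :=
          Finset.sum_image fun a _ b _ h => by simpa using h
      _ ≤ ∑ m ∈ twoSplitUpTo N, 1 / 2 * (m : ℝ) ^ (-s) := by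
          refine Finset.sum_le_sum fun m _ => ?_
          rw [Nat.cast_mul, Real.mul_rpow (by positivity) (by positivity)]
          refine mul_le_mul_of_nonneg_right ?_ (by positivity)
          calc ((2 : ℕ) : ℝ) ^ (-s) ≤ (2 : ℝ) ^ (-1 : ℝ) := by
                push_cast
                exact Real.rpow_le_rpow_of_exponent_le one_le_two (by linarith)
            _ = 1 / 2 := by rw [Real.rpow_neg_one]; norm_num
      _ = _ := by rw [Finset.mul_sum]
  have h2 := Finset.sum_filter_add_sum_filter_not (twoSplitUpTo N) (fun n => 2 ∣ n)
    (fun n => (n : ℝ) ^ (-s))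
  linarith

lemma exists_sum_inv_twoSplit_le : ∃ C : ℝ, 0 < C ∧ ∀ᶠ N : ℕ in atTop,
    ∑ n ∈ twoSplitUpTo N, 1 / (n : ℝ) ≤ C * √(Real.log N) := by
  obtain ⟨C, hC, hev⟩ := exists_norm_LSeries_le
  have hlog : Tendsto (fun N : ℕ => Real.log N) atTop atTop :=
    Real.tendsto_log_atTop.comp tendsto_natCast_atTop_atTop
  have hs : Tendsto (fun N : ℕ => 1 + (Real.log N)⁻¹) atTop (𝓝[>] 1) := by
    refine tendsto_nhdsWithin_iff.2 ⟨?_, ?_⟩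
    · simpa using (tendsto_inv_atTop_zero.comp hlog).const_add 1
    · filter_upwards [hlog.eventually_gt_atTop 0] with N hN
      simpa using hN
  -- Take s = 1 + 1/log N: for n ≤ N, 1/n ≤ e·n^(-s), which accounts for the factor e; the 2
  -- restores the even members, and C/(s - 1) = C log N.
  refine ⟨Real.exp 1 * (2 * √C), by positivity, ?_⟩
  filter_upwards [hs.eventually hev, hlog.eventually_gt_atTop 0] with N hN hpos
  set s := 1 + (Real.log N)⁻¹ with hsdef
  have hs1 : 1 < s := by rw [hsdef]; linarith [inv_pos.2 hpos]
  have hN0 : (0 : ℝ) < N := by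
    rcases Nat.eq_zero_or_pos N with rfl | h
    · simp at hpos
    · exact_mod_cast h
  have h1 : ∑ n ∈ twoSplitUpTo N, 1 / (n : ℝ) ≤
      Real.exp 1 * ∑ n ∈ twoSplitUpTo N, (n : ℝ) ^ (-s) := by
    rw [Finset.mul_sum]
    refine Finset.sum_le_sum fun n hn => ?_
    obtain ⟨hn1, hn2⟩ := mem_twoSplitUpTo.1 hn
    have hn0 : (0 : ℝ) < n := by exact_mod_cast Nat.pos_of_ne_zero hn2.1
    have hle : Real.log n ≤ Real.log N := Real.log_le_log hn0 (by exact_mod_cast hn1)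
    rw [Real.rpow_def_of_pos hn0, ← Real.exp_add, one_div, ← Real.exp_log hn0, ← Real.exp_neg,
      Real.exp_log hn0]
    refine Real.exp_le_exp.2 ?_
    have : Real.log n * (Real.log N)⁻¹ ≤ 1 := by
      rw [← div_eq_mul_inv]; exact (div_le_one hpos).2 hle
    rw [hsdef]
    linarith
  have h2 : ∑ n ∈ twoSplitUpTo N with ¬ 2 ∣ n, (n : ℝ) ^ (-s) ≤ √(C * Real.log N) := by
    refine Real.le_sqrt_of_sq_le ?_
    refine (sq_sum_rpow_le_norm_LSeries hs1 _ fun a ha => ?_).trans (hN.trans_eq ?_)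
    · obtain ⟨ha1, ha2⟩ := Finset.mem_filter.1 ha
      exact ⟨(mem_twoSplitUpTo.1 ha1).2, ha2⟩
    · rw [hsdef, add_sub_cancel_left, div_inv_eq_mul]
  calc ∑ n ∈ twoSplitUpTo N, 1 / (n : ℝ)
      ≤ Real.exp 1 * (2 * √(C * Real.log N)) :=
        h1.trans (mul_le_mul_of_nonneg_left ((sum_rpow_twoSplit_le hs1 N).trans
          (mul_le_mul_of_nonneg_left h2 zero_le_two)) (by positivity))
    _ = Real.exp 1 * (2 * √C) * √(Real.log N) := by rw [Real.sqrt_mul hC.le]; ring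

open Classical in
/-- The indicator function of `IsTwoSplit`. -/
noncomputable def twoSplitIndicator : ArithmeticFunction ℝ :=
  ⟨fun n => if IsTwoSplit n then 1 else 0, by simp [IsTwoSplit]⟩

lemma twoSplitIndicator_nonneg (n : ℕ) : 0 ≤ twoSplitIndicator n := by
  simp only [twoSplitIndicator, ArithmeticFunction.coe_mk]
  split_ifs <;> norm_num

lemma sum_twoSplitUpTo (N : ℕ) (f : ℕ → ℝ) :
    ∑ n ∈ twoSplitUpTo N, f n = ∑ n ∈ Finset.Ioc 0 N, twoSplitIndicator n * f n := by
  rw [twoSplitUpTo, Finset.sum_filter]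
  refine Finset.sum_congr rfl fun n _ => ?_
  simp [twoSplitIndicator]

-- Expand log n = ∑ Λ(d) over d ∣ n; since the set is closed under divisors, the indicator at n is
-- at most the indicator at each n/d.
open ArithmeticFunction in
lemma twoSplitIndicator_mul_log_le (n : ℕ) :
    twoSplitIndicator n * Real.log n ≤ (twoSplitIndicator * vonMangoldt) n := by
  rw [← vonMangoldt_sum, ArithmeticFunction.mul_apply,
    Nat.sum_divisorsAntidiagonal' (f := fun a b => twoSplitIndicator a * vonMangoldt b),
    Finset.mul_sum]
  refine Finset.sum_le_sum fun d hd => ?_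
  refine mul_le_mul_of_nonneg_right ?_ vonMangoldt_nonneg
  simp only [twoSplitIndicator, ArithmeticFunction.coe_mk]
  have hdvd : n / d ∣ n := Nat.div_dvd_of_dvd (Nat.dvd_of_mem_divisors hd)
  by_cases h : IsTwoSplit n
  · simp [h, h.of_dvd hdvd]
  · rw [if_neg h]
    split_ifs <;> norm_num

/-- Write log N = log n + log(N/n). The first part is bounded by the convolution with Λ and
Chebyshev's ψ(x) ≤ (log 4 + 4)x; the second uses log(N/n) ≤ N/n and adds the final 1 to the
constant. -/
lemma card_twoSplit_mul_log_le (N : ℕ) :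
    ((twoSplitUpTo N).card : ℝ) * Real.log N ≤
      (Real.log 4 + 5) * N * ∑ n ∈ twoSplitUpTo N, 1 / (n : ℝ) := by
  have h1 : ∑ n ∈ twoSplitUpTo N, Real.log n ≤
      (Real.log 4 + 4) * N * ∑ n ∈ twoSplitUpTo N, 1 / (n : ℝ) := by
    rw [sum_twoSplitUpTo, sum_twoSplitUpTo]
    refine (Finset.sum_le_sum fun n _ => twoSplitIndicator_mul_log_le n).trans ?_
    rw [ArithmeticFunction.sum_Ioc_mul_eq_sum_sum, Finset.mul_sum]
    refine Finset.sum_le_sum fun m hm => ?_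
    have h2 : ∑ d ∈ Finset.Ioc 0 (N / m), ArithmeticFunction.vonMangoldt d ≤
        (Real.log 4 + 4) * (N / m) := by
      have h3 := Chebyshev.psi_le_const_mul_self (x := ((N / m : ℕ) : ℝ)) (by positivity)
      rw [Chebyshev.psi, Nat.floor_natCast] at h3
      refine h3.trans (mul_le_mul_of_nonneg_left Nat.cast_div_le ?_)
      have := Real.log_nonneg (show (1 : ℝ) ≤ 4 by norm_num)
      linarith
    refine (mul_le_mul_of_nonneg_left h2 (twoSplitIndicator_nonneg m)).trans_eq ?_
    ring
  have h2 : ∑ n ∈ twoSplitUpTo N, (Real.log N - Real.log n) ≤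
      N * ∑ n ∈ twoSplitUpTo N, 1 / (n : ℝ) := by
    rw [Finset.mul_sum]
    refine Finset.sum_le_sum fun n hn => ?_
    obtain ⟨hn1, hn2⟩ := mem_twoSplitUpTo.1 hn
    have hn0 : (0 : ℝ) < n := by exact_mod_cast Nat.pos_of_ne_zero hn2.1
    have hN0 : (0 : ℝ) < N := hn0.trans_le (by exact_mod_cast hn1)
    rw [← Real.log_div hN0.ne' hn0.ne', mul_one_div]
    exact Real.log_le_self (by positivity)
  rw [Finset.sum_sub_distrib, Finset.sum_const, nsmul_eq_mul] at h2
  linarith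

lemma log_natCast_add_two_pos (n : ℕ) : 0 < Real.log ((n : ℝ) + 2) :=
  Real.log_pos (by have : (0 : ℝ) ≤ n := by positivity
                   linarith)

lemma half_le_log_natCast_add_two (n : ℕ) : 1 / 2 ≤ Real.log ((n : ℝ) + 2) := by
  have h1 : Real.log 2 ≤ Real.log ((n : ℝ) + 2) :=
    Real.log_le_log two_pos (by have : (0 : ℝ) ≤ n := by positivity
                                linarith)
  linarith [Real.log_two_gt_d9]

lemma exists_card_twoSplit_le : ∃ C : ℝ, 0 < C ∧ ∀ N : ℕ,
    ((twoSplitUpTo N).card : ℝ) ≤ C * (N / √(Real.log (N + 2))) := by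
  obtain ⟨C, hC, hev⟩ := exists_sum_inv_twoSplit_le
  obtain ⟨N₀, hN₀⟩ := eventually_atTop.1 hev
  have h4 : 0 ≤ Real.log 4 := Real.log_nonneg (by norm_num)
  set D := (Real.log 4 + 5) * C * √2 with hD
  have hD0 : 0 < D := by positivity
  -- `D` serves large N, where N ≥ 2 gives N + 2 ≤ N² and costs the √2. The other constant absorbs N
  -- < N₀ + 2 through the trivial count N.
  refine ⟨max D √(Real.log ((N₀ + 2 : ℕ) + 2)), lt_max_of_lt_left hD0, fun N => ?_⟩
  have hl := log_natCast_add_two_pos N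
  have hsl := Real.sqrt_pos.2 hl
  by_cases hN : N₀ + 2 ≤ N
  · have h1 : N₀ ≤ N := by omega
    have h2 : 2 ≤ N := by omega
    have h2' : (2 : ℝ) ≤ N := by exact_mod_cast h2
    have hlog : 0 < Real.log N := Real.log_pos (by linarith)
    have hsq := Real.sqrt_pos.2 hlog
    have h3 := (card_twoSplit_mul_log_le N).trans
      (mul_le_mul_of_nonneg_left (hN₀ N h1) (by positivity))
    have h5 : ((twoSplitUpTo N).card : ℝ) * √(Real.log N) ≤ (Real.log 4 + 5) * C * N := by
      rw [← mul_le_mul_iff_left₀ hsq, mul_assoc, Real.mul_self_sqrt hlog.le]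
      linarith
    have h6 : Real.log (N + 2) ≤ 2 * Real.log N := by
      rw [← Real.log_rpow (by linarith)]
      refine Real.log_le_log (by linarith) ?_
      norm_num
      nlinarith
    have h7 : √(Real.log (N + 2)) ≤ √2 * √(Real.log N) := by
      rw [← Real.sqrt_mul zero_le_two]
      exact Real.sqrt_le_sqrt h6
    refine le_trans ?_ (mul_le_mul_of_nonneg_right (le_max_left _ _) (by positivity))
    rw [← mul_div_assoc, le_div_iff₀ hsl]
    calc ((twoSplitUpTo N).card : ℝ) * √(Real.log (N + 2))
        ≤ (twoSplitUpTo N).card * (√2 * √(Real.log N)) :=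
          mul_le_mul_of_nonneg_left h7 (by positivity)
      _ = √2 * ((twoSplitUpTo N).card * √(Real.log N)) := by ring
      _ ≤ √2 * ((Real.log 4 + 5) * C * N) := mul_le_mul_of_nonneg_left h5 (by positivity)
      _ = D * N := by rw [hD]; ring
  · have hcard : ((twoSplitUpTo N).card : ℝ) ≤ N := by
      have : (twoSplitUpTo N).card ≤ N :=
        (Finset.card_le_card fun n hn => Finset.mem_Ioc.2
          ⟨Nat.pos_of_ne_zero (mem_twoSplitUpTo.1 hn).2.1, (mem_twoSplitUpTo.1 hn).1⟩).trans
          (Nat.card_Ioc 0 N).le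
      exact_mod_cast this
    have h1 : (N : ℝ) ≤ (N₀ + 2 : ℕ) := by exact_mod_cast (not_le.1 hN).le
    refine le_trans ?_ (mul_le_mul_of_nonneg_right (le_max_right _ _) (by positivity))
    rw [← mul_div_assoc, le_div_iff₀ hsl, mul_comm]
    exact mul_le_mul (Real.sqrt_le_sqrt (Real.log_le_log (by positivity) (by linarith)))
      hcard (by positivity) (by positivity)

/-- The numbers of the form `g ^ 2 * k` with `g > 0` and `k` satisfying `IsTwoSplit`. -/
def IsSqMulTwoSplit (n : ℕ) : Prop := ∃ g k : ℕ, 0 < g ∧ n = g ^ 2 * k ∧ IsTwoSplit k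

/-- Replacing log(N/g² + 2) by log(N + 2) loses at most a factor 4g, that is 2√g after the root. The
decay g^(-2) becomes g^(-3/2), which is still summable over g. -/
lemma card_twoSplitUpTo_div_sq_le {C : ℝ} (hC0 : 0 < C)
    (hC : ∀ N : ℕ, ((twoSplitUpTo N).card : ℝ) ≤ C * (N / √(Real.log (N + 2)))) (N : ℕ) {g : ℕ}
    (hg : 0 < g) :
    ((twoSplitUpTo (N / g ^ 2)).card : ℝ) ≤
      2 * C * (N / √(Real.log (N + 2))) * (g : ℝ) ^ (-(3 / 2) : ℝ) := by
  have hg1 : (1 : ℝ) ≤ g := by exact_mod_cast hg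
  have hg0 : (0 : ℝ) < g := by linarith
  set m := N / g ^ 2 with hm
  have hl := log_natCast_add_two_pos N
  have hlm := log_natCast_add_two_pos m
  have hm1 : (m : ℝ) ≤ N / (g : ℝ) ^ 2 := by
    have := Nat.cast_div_le (α := ℝ) (m := N) (n := g ^ 2)
    rwa [Nat.cast_pow] at this
  have hm2 : (N : ℝ) + 2 ≤ (g : ℝ) ^ 2 * (m + 2) := by
    have h1 : N < g ^ 2 * (m + 1) := Nat.lt_mul_div_succ N (by positivity)
    have h2 : N + 2 ≤ g ^ 2 * (m + 2) := by nlinarith [Nat.one_le_pow 2 g hg]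
    exact_mod_cast h2
  have hlog : Real.log (N + 2) ≤ 4 * g * Real.log (m + 2) := by
    have h1 : Real.log (N + 2) ≤ 2 * Real.log g + Real.log (m + 2) := by
      refine (Real.log_le_log (by positivity) hm2).trans_eq ?_
      rw [Real.log_mul (by positivity) (by positivity), Real.log_pow]
      norm_num
    have h2 := Real.log_le_sub_one_of_pos hg0
    have h3 := half_le_log_natCast_add_two m
    nlinarith
  have hsqrt : √(Real.log (N + 2)) ≤ 2 * √g * √(Real.log (m + 2)) := by
    rw [show (2 : ℝ) * √g * √(Real.log (m + 2)) = √(4 * g * Real.log (m + 2)) by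
      rw [Real.sqrt_mul (by positivity), Real.sqrt_mul (by norm_num),
        show (4 : ℝ) = 2 ^ 2 by norm_num, Real.sqrt_sq zero_le_two]]
    exact Real.sqrt_le_sqrt hlog
  have hpow : (g : ℝ) ^ (-(3 / 2) : ℝ) = √g / (g : ℝ) ^ 2 := by
    rw [Real.sqrt_eq_rpow, ← Real.rpow_natCast, ← Real.rpow_sub hg0]
    norm_num
  refine (hC m).trans ?_
  rw [hpow]
  have hs1 := Real.sqrt_pos.2 hl
  have hs2 := Real.sqrt_pos.2 hlm
  calc C * (m / √(Real.log (m + 2)))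
      ≤ C * ((N / (g : ℝ) ^ 2) * (2 * √g / √(Real.log (N + 2)))) := by
        refine mul_le_mul_of_nonneg_left ?_ hC0.le
        rw [div_eq_mul_one_div]
        refine mul_le_mul hm1 ?_ (by positivity) (by positivity)
        rw [div_le_div_iff₀ hs2 hs1, one_mul]
        exact hsqrt
    _ = _ := by ring

open Classical in
lemma exists_card_isSqMulTwoSplit_le : ∃ C : ℝ, 0 < C ∧ ∀ N : ℕ,
    (((Finset.range (N + 1)).filter IsSqMulTwoSplit).card : ℝ) ≤
      C * (N / √(Real.log (N + 2))) := by
  obtain ⟨C, hC0, hC⟩ := exists_card_twoSplit_le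
  have hsum : Summable fun g : ℕ => (g : ℝ) ^ (-(3 / 2) : ℝ) :=
    Real.summable_nat_rpow.2 (by norm_num)
  set T := ∑' g : ℕ, (g : ℝ) ^ (-(3 / 2) : ℝ) with hT
  have hT0 : 0 ≤ T := tsum_nonneg fun _ => by positivity
  refine ⟨2 * C * (T + 1), by positivity, fun N => ?_⟩
  have hsub : (Finset.range (N + 1)).filter IsSqMulTwoSplit ⊆
      (Finset.Ioc 0 N).biUnion fun g => (twoSplitUpTo (N / g ^ 2)).image fun k => g ^ 2 * k := by
    intro n hn
    obtain ⟨hn1, g, k, hg, rfl, hk⟩ := Finset.mem_filter.1 hn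
    have hn1 := Nat.lt_succ_iff.1 (Finset.mem_range.1 hn1)
    have hk1 : 1 ≤ k := Nat.pos_of_ne_zero hk.1
    refine Finset.mem_biUnion.2 ⟨g, Finset.mem_Ioc.2 ⟨hg, by nlinarith⟩,
      Finset.mem_image.2 ⟨k, mem_twoSplitUpTo.2 ⟨?_, hk⟩, rfl⟩⟩
    rw [Nat.le_div_iff_mul_le (by positivity)]
    linarith
  have h1 : ((Finset.range (N + 1)).filter IsSqMulTwoSplit).card ≤
      ∑ g ∈ Finset.Ioc 0 N, (twoSplitUpTo (N / g ^ 2)).card :=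
    (Finset.card_le_card hsub).trans (Finset.card_biUnion_le.trans
      (Finset.sum_le_sum fun g _ => Finset.card_image_le))
  have h1' : (((Finset.range (N + 1)).filter IsSqMulTwoSplit).card : ℝ) ≤
      ∑ g ∈ Finset.Ioc 0 N, ((twoSplitUpTo (N / g ^ 2)).card : ℝ) := by exact_mod_cast h1
  have hX : 0 ≤ 2 * C * (N / √(Real.log (N + 2))) := by positivity
  calc (((Finset.range (N + 1)).filter IsSqMulTwoSplit).card : ℝ)
      ≤ ∑ g ∈ Finset.Ioc 0 N,
          2 * C * (N / √(Real.log (N + 2))) * (g : ℝ) ^ (-(3 / 2) : ℝ) :=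
        h1'.trans (Finset.sum_le_sum fun g hg =>
          card_twoSplitUpTo_div_sq_le hC0 hC N (Finset.mem_Ioc.1 hg).1)
    _ ≤ 2 * C * (N / √(Real.log (N + 2))) * (T + 1) := by
        rw [← Finset.mul_sum]
        refine mul_le_mul_of_nonneg_left ?_ hX
        have := hsum.sum_le_tsum (Finset.Ioc 0 N) fun _ _ => by positivity
        linarith
    _ = _ := by ring

end Counting

/-! ### From the counting function to the power series -/

section PowerSum

/-- This freezes the logarithm at the scale M = 1/(1 - z), uniformly in n. It follows from M + 2 ≤
(1 + M/n)(n + 2), log(1 + M/n) ≤ M/n and log(n + 2) ≥ 1/2, which give log(M + 2) ≤ (1 + M/n)² log(n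
+ 2). -/
lemma natCast_div_sqrt_log_le {M : ℝ} (hM : 0 < M) (n : ℕ) :
    (n : ℝ) / √(Real.log (n + 2)) ≤ (n + M) / √(Real.log (M + 2)) := by
  have hlM : 0 < Real.log (M + 2) := Real.log_pos (by linarith)
  have hsM := Real.sqrt_pos.2 hlM
  rcases Nat.eq_zero_or_pos n with rfl | hn
  · simp only [Nat.cast_zero, zero_div]
    positivity
  have hn0 : (0 : ℝ) < n := by exact_mod_cast hn
  have hln := log_natCast_add_two_pos n
  have hsn := Real.sqrt_pos.2 hln
  have h1 : Real.log (M + 2) ≤ (1 + M / n) ^ 2 * Real.log (n + 2) := by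
    have e1 : Real.log (M + 2) ≤ Real.log (1 + M / n) + Real.log (n + 2) := by
      rw [← Real.log_mul (by positivity) (by positivity)]
      refine Real.log_le_log (by positivity) ?_
      have : (1 + M / n) * (n + 2) = n + 2 + M + 2 * (M / n) := by field_simp; ring
      rw [this]
      have : 0 < M / n := by positivity
      linarith
    have e2 : Real.log (1 + M / n) ≤ M / n := by
      have := Real.log_le_sub_one_of_pos (show 0 < 1 + M / n by positivity)
      linarith
    have e3 := half_le_log_natCast_add_two n
    have e4 : 0 < M / n := by positivity
    nlinarith [mul_pos (pow_pos e4 2) hln]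
  have h2 : √(Real.log (M + 2)) ≤ (1 + M / n) * √(Real.log (n + 2)) := by
    refine (Real.sqrt_le_sqrt h1).trans_eq ?_
    rw [Real.sqrt_mul (by positivity), Real.sqrt_sq (by positivity)]
  rw [div_le_div_iff₀ hsn hsM]
  calc (n : ℝ) * √(Real.log (M + 2)) ≤ n * ((1 + M / n) * √(Real.log (n + 2))) :=
        mul_le_mul_of_nonneg_left h2 hn0.le
    _ = (n + M) * √(Real.log (n + 2)) := by field_simp

open Classical in
lemma exists_tsum_isSqMulTwoSplit_le : ∃ C : ℝ, 0 < C ∧ ∀ z : ℝ, 0 < z → z < 1 →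
    ∑' n : ℕ, (if IsSqMulTwoSplit n then z ^ n else 0) ≤
      C * (1 / ((1 - z) * √(Real.log (1 / (1 - z) + 2)))) := by
  obtain ⟨C, hC0, hC⟩ := exists_card_isSqMulTwoSplit_le
  refine ⟨2 * C, by positivity, fun z h0 h1 => ?_⟩
  set M := 1 / (1 - z) with hM
  have hz : 0 < 1 - z := by linarith
  have hM0 : 0 < M := by positivity
  have hlM : 0 < Real.log (M + 2) := Real.log_pos (by linarith)
  have hsM := Real.sqrt_pos.2 hlM
  set f : ℕ → ℝ := fun n => if IsSqMulTwoSplit n then z ^ n else 0 with hf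
  have hgeo := summable_geometric_of_lt_one h0.le h1
  have hfn : ∀ n, 0 ≤ f n := fun n => by
    simp only [hf]; split_ifs <;> positivity
  have hfle : ∀ n, f n ≤ z ^ n := fun n => by
    simp only [hf]; split_ifs
    · exact le_rfl
    · positivity
  have hfs : Summable f := Summable.of_nonneg_of_le hfn hfle hgeo
  -- Abel summation: multiplying by M = ∑ z^n turns the indicator series into that of the counting
  -- function. The bound then comes from ∑ (n + M) z^n ≤ 2M², and one factor M is cancelled.
  have hprod : (∑' n, f n) * M = ∑' n : ℕ,
      (((Finset.range (n + 1)).filter IsSqMulTwoSplit).card : ℝ) * z ^ n := by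
    rw [hM, one_div, ← tsum_geometric_of_lt_one h0.le h1,
      tsum_mul_tsum_eq_tsum_sum_range_of_summable_norm hfs.norm hgeo.norm]
    refine tsum_congr fun n => ?_
    rw [Finset.card_filter, Nat.cast_sum, Finset.sum_mul]
    refine Finset.sum_congr rfl fun k hk => ?_
    have hk : k ≤ n := Nat.lt_succ_iff.1 (Finset.mem_range.1 hk)
    simp only [hf]
    split_ifs
    · rw [← pow_add, Nat.add_sub_cancel' hk, Nat.cast_one, one_mul]
    · simp
  have hs1 : HasSum (fun n : ℕ => (n : ℝ) * z ^ n) (z / (1 - z) ^ 2) :=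
    hasSum_coe_mul_geometric_of_norm_lt_one (by rwa [Real.norm_eq_abs, abs_of_pos h0])
  have hs2 : HasSum (fun n : ℕ => M * z ^ n) (M * (1 - z)⁻¹) :=
    (hasSum_geometric_of_lt_one h0.le h1).mul_left M
  have hs3 := (hs1.add hs2).mul_left (C / √(Real.log (M + 2)))
  have hle : ∀ n : ℕ, (((Finset.range (n + 1)).filter IsSqMulTwoSplit).card : ℝ) * z ^ n ≤
      C / √(Real.log (M + 2)) * (n * z ^ n + M * z ^ n) := by
    intro n
    calc _ ≤ C * ((n + M) / √(Real.log (M + 2))) * z ^ n := by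
          refine mul_le_mul_of_nonneg_right ((hC n).trans ?_) (by positivity)
          exact mul_le_mul_of_nonneg_left (natCast_div_sqrt_log_le hM0 n) hC0.le
      _ = _ := by ring
  have hbound : (∑' n, f n) * M ≤ C / √(Real.log (M + 2)) * (2 * M ^ 2) := by
    rw [hprod]
    refine (Summable.tsum_le_tsum hle (Summable.of_nonneg_of_le (fun _ => by positivity) hle
      hs3.summable) hs3.summable).trans ?_
    rw [hs3.tsum_eq]
    refine mul_le_mul_of_nonneg_left ?_ (by positivity)
    have e1 : z / (1 - z) ^ 2 ≤ M ^ 2 := by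
      rw [hM, one_div, inv_pow, div_eq_mul_inv]
      exact mul_le_of_le_one_left (by positivity) h1.le
    have e2 : M * (1 - z)⁻¹ = M ^ 2 := by rw [hM, one_div]; ring
    linarith
  have hfin : ∑' n, f n ≤ C / √(Real.log (M + 2)) * (2 * M) := by
    refine le_of_mul_le_mul_right (hbound.trans_eq ?_) hM0
    ring
  refine hfin.trans_eq ?_
  rw [hM]
  field_simp

lemma summable_pow_p₁_pos {z : ℝ} (h0 : 0 < z) (h1 : z < 1) :
    Summable fun n : {n : ℕ+ // 0 < p₁ n} => z ^ (n : ℕ) :=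
  (summable_geometric_of_lt_one h0.le h1).comp_injective
    (PNat.coe_injective.comp Subtype.val_injective)

open Classical in
lemma tsum_p₁_pos_le {z : ℝ} (h0 : 0 < z) (h1 : z < 1) :
    ∑' n : {n : ℕ+ // 0 < p₁ n}, z ^ (n : ℕ) ≤
      ∑' n : ℕ, (if IsSqMulTwoSplit n then z ^ n else 0) := by
  set f : ℕ → ℝ := fun n => if IsSqMulTwoSplit n then z ^ n else 0 with hf
  have hfn : ∀ n, 0 ≤ f n := fun n => by
    simp only [hf]; split_ifs <;> positivity
  have hfle : ∀ n, f n ≤ z ^ n := fun n => by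
    simp only [hf]; split_ifs
    · exact le_rfl
    · positivity
  have hfs : Summable f :=
    Summable.of_nonneg_of_le hfn hfle (summable_geometric_of_lt_one h0.le h1)
  refine le_trans (le_of_eq ?_) (tsum_comp_le_tsum_of_inj hfs hfn
    (PNat.coe_injective.comp (Subtype.val_injective (p := fun n : ℕ+ => 0 < p₁ n))))
  refine tsum_congr fun n => ?_
  obtain ⟨r, j, hr, _, h⟩ := exists_eq_of_p₁_ne_zero n.2.ne'
  have : IsSqMulTwoSplit ((n : ℕ+) : ℕ) := exists_sq_mul_isTwoSplit (PNat.ne_zero _) hr h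
  simp [hf, this]

theorem isBigO_tsum_p₁_pos : (fun z : ℝ => ∑' n : {n : ℕ+ // 0 < p₁ n}, z ^ (n : ℕ))
    =O[𝓝[<] (1 : ℝ)] (fun z : ℝ => 1 / ((1 - z) * Real.sqrt (Real.log (1 / (1 - z))))) := by
  obtain ⟨C, hC0, hC⟩ := exists_tsum_isSqMulTwoSplit_le
  refine IsBigO.of_bound C ?_
  filter_upwards [Ioo_mem_nhdsLT (zero_lt_one' ℝ)] with z hz
  obtain ⟨h0, h1⟩ := hz
  have hz : 0 < 1 - z := sub_pos.2 h1
  have hM : 1 < 1 / (1 - z) := by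
    rw [lt_div_iff₀ hz]
    linarith
  have hl := Real.log_pos hM
  have hs := Real.sqrt_pos.2 hl
  rw [Real.norm_of_nonneg (tsum_nonneg fun _ => by positivity),
    Real.norm_of_nonneg (by positivity)]
  refine ((tsum_p₁_pos_le h0 h1).trans (hC z h0 h1)).trans ?_
  refine mul_le_mul_of_nonneg_left ?_ hC0.le
  refine one_div_le_one_div_of_le (by positivity) (mul_le_mul_of_nonneg_left ?_ hz.le)
  -- The shift by 2 inside the logarithm only enlarges the denominator, so it can be dropped.
  exact Real.sqrt_le_sqrt (Real.log_le_log (by positivity) (by linarith))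

end PowerSum

theorem mainTheorem1 :
    (∀ z : ℝ, 0 < z → z < 1 → Summable (fun n : ℕ+ => (p₁ n : ℝ) * z ^ (n : ℕ))) ∧
    (fun z : ℝ => ∑' n : ℕ+, (p₁ n : ℝ) * z ^ (n : ℕ))
      =O[𝓝[<] (1 : ℝ)] (fun z : ℝ => 1 / (1 - z)) ∧
    (∀ z : ℝ, 0 < z → z < 1 → Summable (fun n : {n : ℕ+ // 0 < p₁ n} => z ^ (n : ℕ))) ∧
    (fun z : ℝ => ∑' n : {n : ℕ+ // 0 < p₁ n}, z ^ (n : ℕ))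
      =O[𝓝[<] (1 : ℝ)] (fun z : ℝ => 1 / ((1 - z) * Real.sqrt (Real.log (1 / (1 - z))))) :=
  ⟨fun _ h0 h1 => summable_p₁_mul_pow h0 h1, isBigO_tsum_p₁,
    fun _ h0 h1 => summable_pow_p₁_pos h0 h1, isBigO_tsum_p₁_pos⟩
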